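/- Let $G_0=(V_1\cup V_2,E)$ be a finite bipartite graph with parts $V_1,V_2$. Let $G$ be $G_0$ together with two new isolated vertices, and number the vertices of $G$ as $v_1,\dots,v_n$ so that first come the vertices of $V_1$, then the two new vertices, then the vertices of $V_2$ (hence $j\ge i+3$ for every edge $v_iv_j$ with $i<j$). Put $y=10n^2$; "joining $a$ and $b$ by a path of length $m$" means adding $m-1$ new inner vertices. The graph $G'$ is built as follows. * For $c\in\{t,b\}$ take vertices $u^c_1,\dots,u^c_n$ and join $u^c_i$ to $u^c_{i+1}$ by a path of length $y$ (the top line for $c=t$, the bottom line for $c=b$). To each of $u^t_1,u^t_n,u^b_1,u^b_n$ attach a path on three new vertices by an edge to its middle vertex; let $u^t_\ell,u^t_r,u^b_\ell,u^b_r$, respectively, be an arbitrarily chosen end vertex of that three-vertex path. * For each $i$ take a cycle of length $2n+2$ formed by the two paths $a^t_i,l^i_1,\dots,l^i_n,a^b_i$ and $a^t_i,r^i_1,\dots,r^i_n,a^b_i$, and join $a^t_i$ to $u^t_i$ and $a^b_i$ to $u^b_i$ by paths of length $y$. * For each edge $v_iv_j$ of $G$ with $i<j$ join $r^i_j$ and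 $r^j_i$ by a path $R_{ij}=R_{ji}$ of length $(j-i+\tfrac32)y$; join the vertex of $R_{ij}$ at distance $y$ along $R_{ij}$ from $r^i_j$ by a path of length $y$ to the vertex of the top line between $u^t_i$ and $u^t_j$ at distance $j$ along the line from $u^t_i$, and join the vertex of $R_{ij}$ at distance $y$ along $R_{ij}$ from $r^j_i$ by a path of length $y$ to the vertex of the top line between $u^t_i$ and $u^t_j$ at distance $i$ along the line from $u^t_j$. A metric basis of a graph is a set $L$ of vertices such that for any two distinct vertices $a,b$ some $x\in L$ has $\operatorname{dist}(x,a)\ne\operatorname{dist}(x,b)$. Let $h\ge 0$ be an integer. Then: 1. If $G$ has a dominating set of size at most $h$, then $G'$ has a metric basis of size at most $h+4$. Consequently, if $G_0$ has a dominating set of size at most $h$, then $G'$ has a metric basis of size at most $(h+2)+4$. 2. More precisely, if $K$ is a dominating set of $G$ of size at most $h$, then $\{u^t_\ell,u^t_r,u^b_\ell,u^b_r\}\cup\{r^i_1: v_i\in K\}$ is a metric basis of $G'$, of size at most $h+4$. 3. For every edge $v_\alpha v_i$ of $G$ and every $1\le j\le n$, the path from $r^\alpha_1$ to $r^i_j$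 that runs along the right-vertices $r^\alpha_1,\dots,r^\alpha_i$, then along $R_{\alpha i}$ to $r^i_\alpha$, then along the right-vertices between $r^i_\alpha$ and $r^i_j$ is the unique shortest path in $G'$ from $r^\alpha_1$ to $r^i_j$. -/

import Mathlib

namespace MetricDim

/-- `K` is a dominating set of `G`: the closed neighbourhood of every vertex meets `K`. -/
def IsDominatingSet {V : Type*} (G : SimpleGraph V) (K : Set V) : Prop :=
  ∀ x, ∃ d ∈ K, d = x ∨ G.Adj x d

/-- `L` is a metric basis (resolving set) of `G`: any two distinct vertices have different distances
to some member of `L`. (Distances are extended, so the notion is also right for disconnected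
graphs.) -/
def IsMetricBasis {W : Type*} (G : SimpleGraph W) (L : Set W) : Prop :=
  ∀ a b, a ≠ b → ∃ x ∈ L, G.edist x a ≠ G.edist x b

/-- `(G, h)` is a yes-instance of the dominating set problem. -/
def HasDominatingSet {V : Type*} (G : SimpleGraph V) (h : ℕ) : Prop :=
  ∃ K : Set V, IsDominatingSet G K ∧ K.encard ≤ h

/-- `(G, k)` is a yes-instance of the metric dimension problem. -/
def HasMetricBasis {W : Type*} (G : SimpleGraph W) (k : ℕ) : Prop :=
  ∃ L : Set W, IsMetricBasis G L ∧ L.encard ≤ k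

/-- The disjoint union of `G` with two isolated vertices. -/
def addTwoIsolated {V : Type*} (G : SimpleGraph V) : SimpleGraph (V ⊕ Fin 2) :=
  SimpleGraph.sum G ⊥

/-- The graph on `{0, …, n - 1}` obtained from `G` by a numbering of its vertices. -/
def numbered {V : Type*} {n : ℕ} (G : SimpleGraph V) (num : V ≃ Fin n) :
    SimpleGraph (Fin n) :=
  G.comap num.symm

/-- The graph `G` that consists of `G₀` and two isolated vertices, on the set `{0, …, n - 1}` of
indices. -/
abbrev padded {V : Type*} {n : ℕ} (G₀ : SimpleGraph V) (num : V ⊕ Fin 2 ≃ Fin n) :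
    SimpleGraph (Fin n) :=
  numbered (addTwoIsolated G₀) num

/-- Top line or bottom line. -/
inductive Row
  | top
  | bottom

inductive Side
  | left
  | right

/-- The length `y = 10 n ^ 2` of a `y`-path. -/
def y (n : ℕ) : ℕ := 10 * n ^ 2

/-- The length `(j - i + 3/2) y` of the path joining `r^i_j` and `r^j_i` (`y` is even). -/
def edgeLen {n : ℕ} (i j : Fin n) : ℕ := (j.val - i.val) * y n + 3 * (y n / 2)

/-- The vertices of the graph `G'` constructed from a graph `H` on the vertices `v_1, …, v_n`.
The index `i : Fin n` stands for `v_{i+1}`.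
* `line c p`: the vertex at position `p` of the top or bottom line; `u^c_{i+1}` has position `i y`.
* `pendMid c s`, `pendLeaf c s b`: the middle vertex and the two degree-one vertices of the `P_3`
  attached to the left or right endpoint of the line `c`.
* `anchor c i`: the anchors of the `i`-th vertex gadget.
* `arm left i j` and `arm right i j`: the vertices `l^{i+1}_{j+1}` and `r^{i+1}_{j+1}`.
* `spoke c i k`: the inner vertex at distance `k` from the anchor on the `y`-path from that anchor
  to the line `c`.
* `edgePath i j k`: the inner vertex at distance `k` from `r^{i+1}_{j+1}` on the path from
  `r^{i+1}_{j+1}` to `r^{j+1}_{i+1}`, for an edge with `i < j`.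
* `branch left i j k`, `branch right i j k`: the inner vertex at distance `k` from `w_1`, resp.
  `w_2`, on the `y`-path from there to the top line. -/
inductive Vertex {n : ℕ} (H : SimpleGraph (Fin n)) : Type
  | line (c : Row) (p : ℕ) (hp : p ≤ (n - 1) * y n)
  | pendMid (c : Row) (s : Side)
  | pendLeaf (c : Row) (s : Side) (b : Bool)
  | anchor (c : Row) (i : Fin n)
  | arm (s : Side) (i j : Fin n)
  | spoke (c : Row) (i : Fin n) (k : ℕ) (hk : 0 < k ∧ k < y n)
  | edgePath (i j : Fin n) (hij : i < j) (e : H.Adj i j) (k : ℕ) (hk : 0 < k ∧ k < edgeLen i j)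
  | branch (s : Side) (i j : Fin n) (hij : i < j) (e : H.Adj i j) (k : ℕ) (hk : 0 < k ∧ k < y n)

open Vertex in
/-- The edges of `G'`, each listed in one direction. -/
inductive Step {n : ℕ} (H : SimpleGraph (Fin n)) : Vertex H → Vertex H → Prop
  /- the two lines -/
  | line_line (c p hp hp') : Step H (line c p hp) (line c (p + 1) hp')
  /- the four pending `P_3`'s -/
  | leaf_mid (c s b) : Step H (pendLeaf c s b) (pendMid c s)
  | mid_left (c hp) : Step H (pendMid c .left) (line c 0 hp)
  | mid_right (c hp) : Step H (pendMid c .right) (line c ((n - 1) * y n) hp)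
  /- the cycle of a vertex gadget -/
  | top_arm (s i j) : j.val = 0 → Step H (anchor .top i) (arm s i j)
  | arm_arm (s i j j') : j'.val = j.val + 1 → Step H (arm s i j) (arm s i j')
  | arm_bottom (s i j) : j.val + 1 = n → Step H (arm s i j) (anchor .bottom i)
  /- the `y`-paths from the anchors to the lines -/
  | anchor_spoke (c i hk) : Step H (anchor c i) (spoke c i 1 hk)
  | spoke_spoke (c i k hk hk') : Step H (spoke c i k hk) (spoke c i (k + 1) hk')
  | spoke_line (c i k hk p hp) : k + 1 = y n → p = i.val * y n →
      Step H (spoke c i k hk) (line c p hp)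
  /- the path from `r^i_j` to `r^j_i` of an edge gadget -/
  | arm_edge (i j hij e hk) : Step H (arm .right i j) (edgePath i j hij e 1 hk)
  | edge_edge (i j hij e k hk hk') :
      Step H (edgePath i j hij e k hk) (edgePath i j hij e (k + 1) hk')
  | edge_arm (i j hij e k hk) : k + 1 = edgeLen i j →
      Step H (edgePath i j hij e k hk) (arm .right j i)
  /- the `y`-path from `w_1` to the vertex of the top line at distance `j` to the right of `u^t_i` -/
  | edge_branch_left (i j hij e k hk hk') : k = y n →
      Step H (edgePath i j hij e k hk) (branch .left i j hij e 1 hk')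
  | branch_left_line (i j hij e k hk p hp) : k + 1 = y n → p = i.val * y n + (j.val + 1) →
      Step H (branch .left i j hij e k hk) (line .top p hp)
  /- the `y`-path from `w_2` to the vertex of the top line at distance `i` to the left of `u^t_j` -/
  | edge_branch_right (i j hij e k hk hk') : k + y n = edgeLen i j →
      Step H (edgePath i j hij e k hk) (branch .right i j hij e 1 hk')
  | branch_right_line (i j hij e k hk p hp) : k + 1 = y n → p + (i.val + 1) = j.val * y n →
      Step H (branch .right i j hij e k hk) (line .top p hp)
  | branch_branch (s i j hij e k hk hk') :
      Step H (branch s i j hij e k hk) (branch s i j hij e (k + 1) hk')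

/-- The graph `G'`. -/
def reduction {n : ℕ} (H : SimpleGraph (Fin n)) : SimpleGraph (Vertex H) :=
  SimpleGraph.fromRel (Step H)

/-- The vertex `r^i_j`. -/
abbrev rVertex {n : ℕ} (H : SimpleGraph (Fin n)) (i j : Fin n) : Vertex H := .arm .right i j

/-- The vertex `r^i_1`. -/
abbrev rFirst {n : ℕ} (H : SimpleGraph (Fin n)) (i : Fin n) : Vertex H :=
  rVertex H i ⟨0, i.pos⟩

/-- The set of the four corners `u^t_ℓ, u^t_r, u^b_ℓ, u^b_r` and the vertices `r^i_1` with `i ∈ K`.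
The function `b` says which of the two degree-one vertices of each `P_3` is the corner. -/
def basisOf {n : ℕ} (H : SimpleGraph (Fin n)) (b : Row → Side → Bool) (K : Set (Fin n)) :
    Set (Vertex H) :=
  {x | ∃ c s, x = .pendLeaf c s (b c s)} ∪ rFirst H '' K

/-- The vertices of the path `r^α_1, …, r^α_i`, then through the edge gadget of `v_α v_i` to
`r^i_α`, then along the right-vertices to `r^i_j`. -/
def gadgetRoute {n : ℕ} (H : SimpleGraph (Fin n)) (α i j : Fin n) : Set (Vertex H) :=
  {x | (∃ t, t ≤ i ∧ x = rVertex H α t) ∨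
    (∃ (a b : Fin n) (hab : a < b) (e : H.Adj a b) (k : ℕ) (hk : 0 < k ∧ k < edgeLen a b),
      s(a, b) = s(α, i) ∧ x = .edgePath a b hab e k hk) ∨
    (∃ t ∈ Set.uIcc α j, x = rVertex H i t)}

end MetricDim

namespace MetricDim

/-! Distances in `G'` are certified by explicit functions: a 1-Lipschitz function bounds distances
from below, and a function with a smaller neighbour at every vertex except the root bounds them from
above. Such a function is prescribed as a `Profile` on the lines, the pending paths and the cycles
only. `Profile.ext` extends it to spokes and edge gadgets by the minimum over the terminals of the
path or tree in question. The Lipschitz property then amounts to a short list of inequalities, and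
the new vertices have descending neighbours automatically.

Corners. The lines and vertex gadgets form a ladder on which the distance from a corner is 2 plus a
horizontal plus a vertical part; edge gadgets are too long to be shortcuts (`edist_corner`). So the
corners recover column and depth of a ladder vertex, and confuse only the twins `l^i_j`, `r^i_j`.
The sum of the four distances is constant on the ladder and larger on edge gadgets. Inside the edge
gadgets the distances are piecewise affine, and comparing them leaves one family of unresolved
pairs, `Exceptional`: a vertex `k'` steps before the branching point `w_1` of the edge `ab`, and the
vertex `k'` steps up the branch at `w_1` of the edge `ab'`, where `b' = b + 2k'` (and the mirror
images).

Exceptional pairs. A new isolated vertex `m` belongs to every dominating set, and every edge has one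
end on each side of `m`. The shift of the foot by `2k'` that balances the two distances from the
outer corner has the opposite effect from inside, so `r^m_1` resolves the pair
(`Exceptional.edist_ne`).

Twins. If `α` dominates `i` and `α ≠ i`, the edge path exceeds the column distance by `3y/2`, while
a detour over a line costs two spokes, that is `2y`; the difference `y/2` absorbs all terms linear
in `n`. Hence shortest paths from `r^α_1` enter the gadget of `i` at `r^i_α`, on the right side, and
`r^i_j` is nearer than `l^i_j`. The function `gadgetProfile` is exact on this route, and no
descending step leaves the route, which also gives uniqueness
(`exists_unique_shortest_gadgetRoute`). -/

/-! ### Certificates for distances and for unique shortest walks -/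

theorem le_edist_of_lipschitz {W : Type*} {G : SimpleGraph W} {f : W → ℕ}
    (hf : ∀ u v, G.Adj u v → f u ≤ f v + 1) (u v : W) : (f u : ℕ∞) ≤ f v + G.edist u v := by
  have key : ∀ {u v : W} (p : G.Walk u v), f u ≤ f v + p.length := by
    intro u v p
    induction p with
    | nil => simp
    | cons h p ih =>
      have := hf _ _ h
      simp only [SimpleGraph.Walk.length_cons]
      omega
  by_cases h : G.edist u v = ⊤
  · simp [h]
  · obtain ⟨p, hp⟩ := SimpleGraph.exists_walk_of_edist_ne_top h
    rw [← hp]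
    exact_mod_cast key p

/-- If from every vertex of `S` other than `r` one can step to a vertex of `S` where `f` is smaller,
then `f` bounds the distance from `r` on `S`. -/
theorem edist_le_of_descent {W : Type*} {G : SimpleGraph W} {f : W → ℕ} {r : W} {S : Set W}
    (hS : ∀ v ∈ S, v = r ∨ ∃ u ∈ S, G.Adj u v ∧ f u < f v) {v : W} (hv : v ∈ S) :
    G.edist r v ≤ f v := by
  induction h : f v using Nat.strong_induction_on generalizing v with
  | _ m ih =>
    rcases hS v hv with rfl | ⟨u, hu, hadj, hlt⟩
    · simp
    · have h1 := ih (f u) (h ▸ hlt) hu rfl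
      calc G.edist r v ≤ G.edist r u + G.edist u v := G.edist_triangle
        _ ≤ f u + 1 := by
          gcongr
          exact (SimpleGraph.edist_eq_one_iff_adj.2 hadj).le
        _ ≤ m := by
          rw [← h]
          exact_mod_cast hlt

/-- If `g` measures the remaining length along a route `S` and every descending step that starts on
the route stays on the route, then the route is the unique shortest walk to its end. -/
theorem exists_unique_shortest_walk {W : Type*} {G : SimpleGraph W} {g : W → ℕ} {S : Set W} {T : W}
    (hT : T ∈ S) (hinj : Set.InjOn g S) (hT0 : g T = 0)
    (hlip : ∀ u v, G.Adj u v → g u ≤ g v + 1)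
    (hclosed : ∀ u ∈ S, ∀ v, G.Adj u v → g v < g u → v ∈ S)
    (hdesc : ∀ u ∈ S, u ≠ T → ∃ v ∈ S, G.Adj u v ∧ g v < g u) {u : W} (hu : u ∈ S) :
    ∃ P : G.Walk u T, P.length = g u ∧ (∀ x, x ∈ P.support ↔ x ∈ S ∧ g x ≤ g u) ∧
      ∀ Q : G.Walk u T, Q ≠ P → P.length < Q.length := by
  have hlen : ∀ {u v : W} (p : G.Walk u v), g u ≤ g v + p.length := by
    intro u v p
    induction p with
    | nil => simp
    | cons h p ih =>
      have := hlip _ _ h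
      simp only [SimpleGraph.Walk.length_cons]
      omega
  induction h : g u using Nat.strong_induction_on generalizing u with
  | _ m ih =>
    by_cases huT : u = T
    · subst huT
      refine ⟨.nil, by simp; omega, fun x => ?_, fun Q hQ => ?_⟩
      · simp only [SimpleGraph.Walk.support_nil, List.mem_singleton]
        constructor
        · rintro rfl
          exact ⟨hu, h.le⟩
        · rintro ⟨hx, hxm⟩
          exact hinj hx hu (by omega)
      · cases Q with
        | nil => exact absurd rfl hQ
        | cons _ _ => simp
    · obtain ⟨v, hv, hadj, hlt⟩ := hdesc u hu huT
      have h1 := hlip _ _ hadj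
      obtain ⟨P, hP, hsupp, huniq⟩ := ih (g v) (by omega) hv rfl
      refine ⟨.cons hadj P, by simp; omega, fun x => ?_, fun Q hQ => ?_⟩
      · simp only [SimpleGraph.Walk.support_cons, List.mem_cons, hsupp]
        constructor
        · rintro (rfl | ⟨hx, hxv⟩)
          · exact ⟨hu, h.le⟩
          · exact ⟨hx, by omega⟩
        · rintro ⟨hx, hxm⟩
          by_cases hxu : g x = g u
          · exact Or.inl (hinj hx hu hxu)
          · exact Or.inr ⟨hx, by omega⟩
      · cases Q with
        | nil => exact absurd rfl huT
        | @cons _ w _ hw Q' =>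
          simp only [SimpleGraph.Walk.length_cons]
          have h2 := hlen Q'
          -- A first step that does not descend leaves at least `g u` still to go, so the walk is
          -- too long.
          by_cases hgw : g w < g u
          · have hwS := hclosed u hu w hw hgw
            have h3 := hlip _ _ hw
            obtain rfl : w = v := hinj hwS hv (by omega)
            have : Q' ≠ P := fun h => hQ (by rw [h])
            have := huniq Q' this
            omega
          · omega

/-! ### Profiles and their interpolation along the subdivided paths -/

/-- The two numbers differ by at most `d`. -/
def Within (d a b : ℕ) : Prop := a ≤ b + d ∧ b ≤ a + d

/-- A function on the lines, the pending paths and the cycles of the construction. -/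
structure Profile (n : ℕ) where
  line : Row → ℕ → ℕ
  mid : Row → Side → ℕ
  leaf : Row → Side → Bool → ℕ
  anchor : Row → Fin n → ℕ
  arm : Side → Fin n → Fin n → ℕ

/-- The smallest value at position `k` of a path of length `L` that is compatible with the values
`A` and `B` at its two ends and the values `C` and `D` at the far ends of the two paths of length
`Y` that branch off at distance `Y` from the ends. -/
def edgeVal (Y L A B C D k : ℕ) : ℕ :=
  min (min (A + k) (B + (L - k)))
    (min (C + Y + ((k - Y) + (Y - k))) (D + Y + ((k + Y - L) + (L - (k + Y)))))

theorem Within.trans_eq {d a b c : ℕ} (h : Within d a b) (h' : b = c) : Within d a c := h' ▸ h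

theorem Within.min {d a b a' b' : ℕ} (h : Within d a b) (h' : Within d a' b') :
    Within d (min a a') (min b b') := by
  simp only [Within] at *
  omega

theorem edgeVal_succ {Y L A B C D k : ℕ} :
    Within 1 (edgeVal Y L A B C D k) (edgeVal Y L A B C D (k + 1)) := by
  refine Within.min (Within.min ?_ ?_) (Within.min ?_ ?_) <;> constructor <;> omega

/-- The inequalities between the values around an edge path. -/
structure EdgeCompatible (Y L A B C D : ℕ) : Prop where
  ends : Within L A B
  near_left : Within (2 * Y) A C
  far_left : Within L A D
  far_right : Within L B C
  near_right : Within (2 * Y) B D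
  feet : Within L C D

/-- An edge path with its two branches is a tree with four terminals. Their tree distances are `2 *
Y` between an end and its near foot and `L` for every other pair, which are the bounds in
`EdgeCompatible`. Hence at a terminal no other term of the minimum beats its own. -/
theorem EdgeCompatible.edgeVal_zero {Y L A B C D : ℕ} (h : EdgeCompatible Y L A B C D)
    (hL : 2 * Y < L) : edgeVal Y L A B C D 0 = A := by
  have h1 := h.ends.1
  have h2 := h.near_left.1
  have h3 := h.far_left.1
  rw [edgeVal, min_eq_left (a := A + 0), min_eq_left]
  · rfl
  · exact le_min (by omega) (by omega)
  · omega

theorem EdgeCompatible.edgeVal_length {Y L A B C D : ℕ} (h : EdgeCompatible Y L A B C D)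
    (hL : 2 * Y < L) : edgeVal Y L A B C D L = B := by
  have h1 := h.ends.2
  have h2 := h.far_right.1
  have h3 := h.near_right.1
  rw [edgeVal, min_eq_right (a := A + L), min_eq_left]
  · omega
  · exact le_min (by omega) (by omega)
  · omega

theorem EdgeCompatible.foot_left_le {Y L A B C D : ℕ} (h : EdgeCompatible Y L A B C D)
    (hL : 2 * Y < L) : C ≤ edgeVal Y L A B C D Y + Y := by
  have h1 := h.near_left.2
  have h2 := h.far_right.2
  have h3 := h.feet.1
  have : C - Y ≤ edgeVal Y L A B C D Y :=
    le_min (le_min (by omega) (by omega)) (le_min (by omega) (by omega))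
  omega

theorem EdgeCompatible.foot_right_le {Y L A B C D : ℕ} (h : EdgeCompatible Y L A B C D)
    (hL : 2 * Y < L) : D ≤ edgeVal Y L A B C D (L - Y) + Y := by
  have h1 := h.near_right.2
  have h2 := h.far_left.2
  have h3 := h.feet.2
  have : D - Y ≤ edgeVal Y L A B C D (L - Y) :=
    le_min (le_min (by omega) (by omega)) (le_min (by omega) (by omega))
  omega

theorem edgeVal_le_foot_left {Y L A B C D : ℕ} : edgeVal Y L A B C D Y ≤ C + Y := by
  refine (min_le_right _ _).trans ((min_le_left _ _).trans ?_)
  omega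

theorem edgeVal_le_foot_right {Y L A B C D : ℕ} (hL : 2 * Y < L) :
    edgeVal Y L A B C D (L - Y) ≤ D + Y := by
  refine (min_le_right _ _).trans ((min_le_right _ _).trans ?_)
  omega

namespace Profile

variable {n : ℕ} {H : SimpleGraph (Fin n)}

/-- The value of the extension at position `k` of the path of the edge `ij`. -/
def edge (φ : Profile n) (i j : Fin n) (k : ℕ) : ℕ :=
  edgeVal (y n) (edgeLen i j) (φ.arm .right i j) (φ.arm .right j i)
    (φ.line .top (i.val * y n + (j.val + 1))) (φ.line .top (j.val * y n - (i.val + 1))) k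

/-- The extension of a profile to all vertices. -/
def ext (φ : Profile n) : Vertex H → ℕ
  | .line c p _ => φ.line c p
  | .pendMid c s => φ.mid c s
  | .pendLeaf c s b => φ.leaf c s b
  | .anchor c i => φ.anchor c i
  | .arm s i j => φ.arm s i j
  | .spoke c i k _ => min (φ.anchor c i + k) (φ.line c (i.val * y n) + (y n - k))
  | .edgePath i j _ _ k _ => φ.edge i j k
  | .branch .left i j _ _ k _ =>
      min (φ.edge i j (y n) + k) (φ.line .top (i.val * y n + (j.val + 1)) + (y n - k))
  | .branch .right i j _ _ k _ =>
      min (φ.edge i j (edgeLen i j - y n) + k)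
        (φ.line .top (j.val * y n - (i.val + 1)) + (y n - k))

/-- The inequalities that make the extension of a profile `1`-Lipschitz. -/
structure IsLipschitz (φ : Profile n) (H : SimpleGraph (Fin n)) : Prop where
  line : ∀ c p, p + 1 ≤ (n - 1) * y n → Within 1 (φ.line c p) (φ.line c (p + 1))
  leaf : ∀ c s b, Within 1 (φ.leaf c s b) (φ.mid c s)
  mid_left : ∀ c, Within 1 (φ.mid c .left) (φ.line c 0)
  mid_right : ∀ c, Within 1 (φ.mid c .right) (φ.line c ((n - 1) * y n))
  top_arm : ∀ s i (j : Fin n), j.val = 0 → Within 1 (φ.anchor .top i) (φ.arm s i j)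
  arm : ∀ s i (j j' : Fin n), j'.val = j.val + 1 → Within 1 (φ.arm s i j) (φ.arm s i j')
  arm_bottom : ∀ s i (j : Fin n), j.val + 1 = n → Within 1 (φ.arm s i j) (φ.anchor .bottom i)
  spoke : ∀ c (i : Fin n), Within (y n) (φ.anchor c i) (φ.line c (i.val * y n))
  edge : ∀ i j : Fin n, i < j → H.Adj i j →
    EdgeCompatible (y n) (edgeLen i j) (φ.arm .right i j) (φ.arm .right j i)
      (φ.line .top (i.val * y n + (j.val + 1))) (φ.line .top (j.val * y n - (i.val + 1)))

end Profile

/-- This puts `w_1` and `w_2` in the interior of the path, with `w_1` first. -/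
theorem two_mul_y_lt_edgeLen {n : ℕ} {i j : Fin n} (hij : i < j) : 2 * y n < edgeLen i j := by
  have h1 : 1 * y n ≤ (j.val - i.val) * y n := Nat.mul_le_mul_right _ (by omega)
  have hn : 0 < n := i.pos
  have : y n = 2 * (5 * n ^ 2) := by simp only [y]; ring
  have : 0 < n ^ 2 := by positivity
  simp only [edgeLen]
  omega

theorem y_pos {n : ℕ} (hn : 0 < n) : 0 < y n := by
  simp only [y]; positivity

/-- A minimum of terms of slope at most one changes by at most one per step, so the hypotheses are
needed only where a path meets a terminal or a branch begins or ends. -/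
theorem Profile.IsLipschitz.within_ext {n : ℕ} {H : SimpleGraph (Fin n)} {φ : Profile n}
    (h : φ.IsLipschitz H) {u v : Vertex H} (huv : Step H u v) : Within 1 (φ.ext u) (φ.ext v) := by
  cases huv with
  | line_line c p hp hp' => exact h.line c p hp'
  | leaf_mid c s b => exact h.leaf c s b
  | mid_left c hp => exact h.mid_left c
  | mid_right c hp => exact h.mid_right c
  | top_arm s i j hj => exact h.top_arm s i j hj
  | arm_arm s i j j' hj => exact h.arm s i j j' hj
  | arm_bottom s i j hj => exact h.arm_bottom s i j hj
  | anchor_spoke c i hk =>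
    have := h.spoke c i
    simp only [Within, Profile.ext] at *
    omega
  | spoke_spoke c i k hk hk' =>
    simp only [Within, Profile.ext]
    omega
  | spoke_line c i k hk p hp hk' hp' =>
    have := h.spoke c i
    subst hp'
    simp only [Within, Profile.ext] at *
    omega
  | arm_edge i j hij e hk =>
    have h1 := (h.edge i j hij e).edgeVal_zero (two_mul_y_lt_edgeLen hij)
    change Within 1 (φ.arm .right i j) (φ.edge i j (0 + 1))
    rw [← h1]
    exact edgeVal_succ
  | edge_edge i j hij e k hk hk' => exact edgeVal_succ
  | edge_arm i j hij e k hk hk' =>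
    have h1 := (h.edge i j hij e).edgeVal_length (two_mul_y_lt_edgeLen hij)
    have h2 : Within 1 (φ.edge i j k) (φ.edge i j (k + 1)) := edgeVal_succ
    rw [hk'] at h2
    exact h2.trans_eq h1
  | edge_branch_left i j hij e k hk hk' hky =>
    subst hky
    have : φ.edge i j (y n) ≤ φ.line .top (i.val * y n + (j.val + 1)) + y n := edgeVal_le_foot_left
    simp only [Within, Profile.ext]
    omega
  | branch_left_line i j hij e k hk p hp hky hp' =>
    subst hp'
    have : φ.line .top (i.val * y n + (j.val + 1)) ≤ φ.edge i j (y n) + y n :=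
      (h.edge i j hij e).foot_left_le (two_mul_y_lt_edgeLen hij)
    simp only [Within, Profile.ext]
    omega
  | edge_branch_right i j hij e k hk hk' hky =>
    obtain rfl : k = edgeLen i j - y n := by omega
    have : φ.edge i j (edgeLen i j - y n) ≤ φ.line .top (j.val * y n - (i.val + 1)) + y n :=
      edgeVal_le_foot_right (two_mul_y_lt_edgeLen hij)
    simp only [Within, Profile.ext]
    omega
  | branch_right_line i j hij e k hk p hp hky hp' =>
    obtain rfl : p = j.val * y n - (i.val + 1) := by omega
    have : φ.line .top (j.val * y n - (i.val + 1)) ≤ φ.edge i j (edgeLen i j - y n) + y n :=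
      (h.edge i j hij e).foot_right_le (two_mul_y_lt_edgeLen hij)
    simp only [Within, Profile.ext]
    omega
  | branch_branch s i j hij e k hk hk' =>
    cases s <;> simp only [Within, Profile.ext] <;> omega

theorem Profile.IsLipschitz.ext_le {n : ℕ} {H : SimpleGraph (Fin n)} {φ : Profile n}
    (h : φ.IsLipschitz H) (u v : Vertex H) (huv : (reduction H).Adj u v) :
    φ.ext u ≤ φ.ext v + 1 := by
  rw [reduction, SimpleGraph.fromRel_adj] at huv
  rcases huv.2 with h' | h'
  · exact (h.within_ext h').1
  · exact (h.within_ext h').2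

theorem Step.adj {n : ℕ} {H : SimpleGraph (Fin n)} {u v : Vertex H} (h : Step H u v) :
    (reduction H).Adj u v := by
  rw [reduction, SimpleGraph.fromRel_adj]
  refine ⟨?_, Or.inl h⟩
  rintro rfl
  cases h; simp_all

end MetricDim

namespace MetricDim

variable {n : ℕ} {H : SimpleGraph (Fin n)}

/-! ### The scale `y = 2h`, and descent on spokes, edge paths and branches -/

/-- With `h = y / 2` all lengths become integral, and `10 * n ≤ h` is the form in which the size of
`y` enters most later estimates. -/
theorem exists_half_y (hn : 2 ≤ n) : ∃ h, y n = 2 * h ∧ 10 * n ≤ h := by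
  refine ⟨5 * n ^ 2, by simp only [y]; ring, ?_⟩
  nlinarith

theorem edgeLen_add {i j : Fin n} (hij : i < j) {h : ℕ} (hy : y n = 2 * h) :
    edgeLen i j + i.val * y n = j.val * y n + 3 * h := by
  have h1 : y n / 2 = h := by omega
  have h2 : (j.val - i.val) * y n + i.val * y n = j.val * y n := by
    rw [← Nat.add_mul, Nat.sub_add_cancel (le_of_lt hij)]
  rw [edgeLen, h1]
  omega

theorem mul_y_add_le {i j : ℕ} (hij : i < j) : i * y n + y n ≤ j * y n := by
  rw [← Nat.succ_mul]
  exact Nat.mul_le_mul_right _ hij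

theorem mul_y_le (i : Fin n) : i.val * y n ≤ (n - 1) * y n :=
  Nat.mul_le_mul_right _ (by omega)

/-- The value is a minimum of two linear terms; a step towards the terminal that attains it lowers
it. -/
theorem Profile.exists_ext_lt_spoke (φ : Profile n) (c : Row) (i : Fin n) (k : ℕ)
    (hk : 0 < k ∧ k < y n) :
    ∃ u : Vertex H, (reduction H).Adj u (.spoke c i k hk) ∧
      φ.ext u < φ.ext (.spoke c i k hk : Vertex H) := by
  obtain ⟨k, rfl⟩ : ∃ k', k = k' + 1 := ⟨k - 1, by omega⟩
  rcases le_total (φ.anchor c i + (k + 1)) (φ.line c (i.val * y n) + (y n - (k + 1))) with hle | hle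
  · rcases Nat.eq_zero_or_pos k with rfl | hk0
    · exact ⟨.anchor c i, (Step.anchor_spoke c i hk).adj, by simp only [Profile.ext]; omega⟩
    · exact ⟨.spoke c i k ⟨hk0, by omega⟩, (Step.spoke_spoke c i k _ hk).adj, by
        simp only [Profile.ext]; omega⟩
  · by_cases hk1 : k + 1 + 1 = y n
    · exact ⟨.line c (i.val * y n) (mul_y_le i), (Step.spoke_line c i _ hk _ _ hk1 rfl).adj.symm, by
        simp only [Profile.ext]; omega⟩
    · exact ⟨.spoke c i (k + 1 + 1) ⟨by omega, by omega⟩,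
        (Step.spoke_spoke c i _ hk _).adj.symm, by simp only [Profile.ext]; omega⟩

/-- The step goes towards the terminal whose term attains the minimum. If that terminal is a foot
and `k` is its branching point, the step leads into the branch: the last two alternatives. -/
theorem edgeVal_pred_or_succ_or_foot {Y L A B C D k : ℕ} (hk : 0 < k ∧ k < L) (hY : 0 < Y)
    (hL : 2 * Y < L) :
    (k = 1 ∧ A < edgeVal Y L A B C D k) ∨
    (1 < k ∧ edgeVal Y L A B C D (k - 1) < edgeVal Y L A B C D k) ∨
    (k + 1 = L ∧ B < edgeVal Y L A B C D k) ∨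
    (k + 1 < L ∧ edgeVal Y L A B C D (k + 1) < edgeVal Y L A B C D k) ∨
    (k = Y ∧ C + Y ≤ edgeVal Y L A B C D k) ∨ (k + Y = L ∧ D + Y ≤ edgeVal Y L A B C D k) := by
  obtain ⟨P, hP⟩ : ∃ P, P = edgeVal Y L A B C D (k - 1) := ⟨_, rfl⟩
  obtain ⟨Q, hQ⟩ : ∃ Q, Q = edgeVal Y L A B C D k := ⟨_, rfl⟩
  obtain ⟨R, hR⟩ : ∃ R, R = edgeVal Y L A B C D (k + 1) := ⟨_, rfl⟩
  have h1 : P ≤ A + (k - 1) ∧ P ≤ C + Y + ((k - 1 - Y) + (Y - (k - 1))) ∧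
      P ≤ D + Y + ((k - 1 + Y - L) + (L - (k - 1 + Y))) := by
    rw [hP, edgeVal]
    simp only [min_le_iff]
    omega
  have h2 : R ≤ B + (L - (k + 1)) ∧ R ≤ C + Y + ((k + 1 - Y) + (Y - (k + 1))) ∧
      R ≤ D + Y + ((k + 1 + Y - L) + (L - (k + 1 + Y))) := by
    rw [hR, edgeVal]
    simp only [min_le_iff]
    omega
  have h3 : Q = A + k ∨ Q = B + (L - k) ∨ Q = C + Y + ((k - Y) + (Y - k)) ∨
      Q = D + Y + ((k + Y - L) + (L - (k + Y))) := by
    rw [hQ, edgeVal]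
    omega
  rw [← hP, ← hQ, ← hR]
  rcases h3 with h | h | h | h
  · rcases Nat.lt_or_ge 1 k with h' | h'
    · exact Or.inr (Or.inl ⟨h', by omega⟩)
    · exact Or.inl ⟨by omega, by omega⟩
  · rcases Nat.lt_or_ge (k + 1) L with h' | h'
    · exact Or.inr (Or.inr (Or.inr (Or.inl ⟨h', by omega⟩)))
    · exact Or.inr (Or.inr (Or.inl ⟨by omega, by omega⟩))
  · rcases lt_trichotomy k Y with h' | h' | h'
    · exact Or.inr (Or.inr (Or.inr (Or.inl ⟨by omega, by omega⟩)))
    · exact Or.inr (Or.inr (Or.inr (Or.inr (Or.inl ⟨h', by omega⟩))))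
    · exact Or.inr (Or.inl ⟨by omega, by omega⟩)
  · rcases lt_trichotomy (k + Y) L with h' | h' | h'
    · exact Or.inr (Or.inr (Or.inr (Or.inl ⟨by omega, by omega⟩)))
    · exact Or.inr (Or.inr (Or.inr (Or.inr (Or.inr ⟨h', by omega⟩))))
    · exact Or.inr (Or.inl ⟨by omega, by omega⟩)

theorem Profile.exists_ext_lt_edgePath (φ : Profile n) (i j : Fin n) (hij : i < j) (e : H.Adj i j)
    (k : ℕ) (hk : 0 < k ∧ k < edgeLen i j) :
    ∃ u : Vertex H, (reduction H).Adj u (.edgePath i j hij e k hk) ∧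
      φ.ext u < φ.ext (.edgePath i j hij e k hk) := by
  have hL := two_mul_y_lt_edgeLen hij
  rcases edgeVal_pred_or_succ_or_foot (A := φ.arm .right i j) (B := φ.arm .right j i)
    (C := φ.line .top (i.val * y n + (j.val + 1)))
    (D := φ.line .top (j.val * y n - (i.val + 1))) hk (y_pos i.pos) hL with h | h | h | h | h | h
  · obtain ⟨rfl, h⟩ := h
    exact ⟨_, (Step.arm_edge i j hij e hk).adj, h⟩
  · obtain ⟨k, rfl⟩ : ∃ k', k = k' + 1 := ⟨k - 1, by omega⟩
    exact ⟨_, (Step.edge_edge i j hij e k ⟨by omega, by omega⟩ hk).adj, h.2⟩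
  · exact ⟨_, (Step.edge_arm i j hij e k hk h.1).adj.symm, h.2⟩
  · exact ⟨_, (Step.edge_edge i j hij e k hk ⟨by omega, h.1⟩).adj.symm, h.2⟩
  · have hy : 1 < y n := by simp only [y]; nlinarith [i.pos]
    refine ⟨_, (Step.edge_branch_left i j hij e k hk ⟨by omega, hy⟩ h.1).adj.symm, ?_⟩
    refine lt_of_lt_of_le ?_ h.2
    simp only [Profile.ext]
    omega
  · have hy : 1 < y n := by simp only [y]; nlinarith [i.pos]
    refine ⟨_, (Step.edge_branch_right i j hij e k hk ⟨by omega, hy⟩ h.1).adj.symm, ?_⟩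
    refine lt_of_lt_of_le ?_ h.2
    simp only [Profile.ext]
    omega

theorem foot_left_le {i j : Fin n} (hij : i < j) :
    i.val * y n + (j.val + 1) ≤ (n - 1) * y n := by
  have h1 := mul_y_add_le (n := n) (Fin.lt_def.1 hij)
  have h2 := mul_y_le j
  have h3 : n ≤ y n := by simp only [y]; nlinarith [i.pos]
  omega

theorem foot_right_le {i j : Fin n} : j.val * y n - (i.val + 1) ≤ (n - 1) * y n :=
  (Nat.sub_le _ _).trans (mul_y_le j)

/-- Since `n ≤ y`, the subtraction is not truncated. -/
theorem foot_right_add {i j : Fin n} (hij : i < j) :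
    j.val * y n - (i.val + 1) + (i.val + 1) = j.val * y n := by
  have h1 := mul_y_add_le (n := n) (Fin.lt_def.1 hij)
  have h3 : n ≤ y n := by simp only [y]; nlinarith [i.pos]
  omega

theorem Profile.exists_ext_lt_branch (φ : Profile n) (s : Side) (i j : Fin n) (hij : i < j)
    (e : H.Adj i j) (k : ℕ) (hk : 0 < k ∧ k < y n) :
    ∃ u : Vertex H, (reduction H).Adj u (.branch s i j hij e k hk) ∧
      φ.ext u < φ.ext (.branch s i j hij e k hk) := by
  have hL := two_mul_y_lt_edgeLen hij
  obtain ⟨k, rfl⟩ : ∃ k', k = k' + 1 := ⟨k - 1, by omega⟩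
  cases s
  · rcases le_total (φ.edge i j (y n) + (k + 1))
      (φ.line .top (i.val * y n + (j.val + 1)) + (y n - (k + 1))) with hle | hle
    · rcases Nat.eq_zero_or_pos k with rfl | hk0
      · exact ⟨_, (Step.edge_branch_left i j hij e (y n) ⟨by omega, by omega⟩ hk rfl).adj, by
          simp only [Profile.ext]; omega⟩
      · exact ⟨_, (Step.branch_branch .left i j hij e k ⟨hk0, by omega⟩ hk).adj, by
          simp only [Profile.ext]; omega⟩
    · by_cases hk1 : k + 1 + 1 = y n
      · exact ⟨_, (Step.branch_left_line i j hij e _ hk _ (foot_left_le hij) hk1 rfl).adj.symm, by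
          simp only [Profile.ext]; omega⟩
      · exact ⟨_, (Step.branch_branch .left i j hij e _ hk ⟨by omega, by omega⟩).adj.symm, by
          simp only [Profile.ext]; omega⟩
  · rcases le_total (φ.edge i j (edgeLen i j - y n) + (k + 1))
      (φ.line .top (j.val * y n - (i.val + 1)) + (y n - (k + 1))) with hle | hle
    · rcases Nat.eq_zero_or_pos k with rfl | hk0
      · exact ⟨_, (Step.edge_branch_right i j hij e (edgeLen i j - y n) ⟨by omega, by omega⟩ hk
          (by omega)).adj, by simp only [Profile.ext]; omega⟩
      · exact ⟨_, (Step.branch_branch .right i j hij e k ⟨hk0, by omega⟩ hk).adj, by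
          simp only [Profile.ext]; omega⟩
    · by_cases hk1 : k + 1 + 1 = y n
      · exact ⟨_, (Step.branch_right_line i j hij e _ hk _ foot_right_le hk1
          (foot_right_add hij)).adj.symm, by simp only [Profile.ext]; omega⟩
      · exact ⟨_, (Step.branch_branch .right i j hij e _ hk ⟨by omega, by omega⟩).adj.symm, by
          simp only [Profile.ext]; omega⟩

/-! ### Exact distances from the four corners -/

/-- The distance from position `p` of a line to its left or right end. -/
def endDist (n : ℕ) : Side → ℕ → ℕ
  | .left, p => p
  | .right, p => (n - 1) * y n - p

/-- The position of the left or right end of a line. -/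
def endPos (n : ℕ) : Side → ℕ
  | .left => 0
  | .right => (n - 1) * y n

/-- The distance between the lines `c` and `c'`. -/
def lineDist (n : ℕ) : Row → Row → ℕ
  | .top, .top => 0
  | .bottom, .bottom => 0
  | _, _ => 2 * y n + n + 1

/-- The distance from line `c` to the anchor `c'` of the vertex gadget above or below it. -/
def anchorDist (n : ℕ) : Row → Row → ℕ
  | .top, .top => y n
  | .bottom, .bottom => y n
  | _, _ => y n + n + 1

/-- The distance from line `c` to the `j`-th vertices of the arms of a vertex gadget. -/
def armDist (n : ℕ) : Row → ℕ → ℕ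
  | .top, j => y n + 1 + j
  | .bottom, j => y n + n - j

/-- The distances from the corner at the end `s` of the line `c`. -/
def cornerProfile (n : ℕ) (b₀ : Bool) (c : Row) (s : Side) : Profile n where
  line c' p := 2 + lineDist n c c' + endDist n s p
  mid c' s' := match c, s, c', s' with
    | .top, .left, .top, .left => 1
    | .top, .right, .top, .right => 1
    | .bottom, .left, .bottom, .left => 1
    | .bottom, .right, .bottom, .right => 1
    | _, _, _, _ => 2 + lineDist n c c' + endDist n s (endPos n s') + 1
  leaf c' s' b := match c, s, c', s' with
    | .top, .left, .top, .left => if b = b₀ then 0 else 2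
    | .top, .right, .top, .right => if b = b₀ then 0 else 2
    | .bottom, .left, .bottom, .left => if b = b₀ then 0 else 2
    | .bottom, .right, .bottom, .right => if b = b₀ then 0 else 2
    | _, _, _, _ => 2 + lineDist n c c' + endDist n s (endPos n s') + 2
  anchor c' i := 2 + anchorDist n c c' + endDist n s (i.val * y n)
  arm _ i j := 2 + armDist n c j.val + endDist n s (i.val * y n)

/-- In the edge case, the path is longer by `3 * h` than the horizontal distance that it bridges,
whereas its ends and feet differ in depth by at most `2 * h + n`. So it offers no shortcut. -/
theorem cornerProfile_isLipschitz (hn : 2 ≤ n) (b₀ : Bool) (c : Row) (s : Side) :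
    (cornerProfile n b₀ c s).IsLipschitz H where
  line c' p hp := by
    cases s <;> constructor <;> simp only [cornerProfile, endDist] <;> omega
  leaf c' s' b := by
    cases c <;> cases s <;> cases c' <;> cases s' <;> constructor <;>
      simp only [cornerProfile] <;> (try split) <;> omega
  mid_left c' := by
    cases c <;> cases s <;> cases c' <;> constructor <;>
      simp only [cornerProfile, lineDist, endDist, endPos] <;> omega
  mid_right c' := by
    cases c <;> cases s <;> cases c' <;> constructor <;>
      simp only [cornerProfile, lineDist, endDist, endPos] <;> omega
  top_arm s' i j hj := by
    cases c <;> constructor <;> simp only [cornerProfile, anchorDist, armDist] <;> omega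
  arm s' i j j' hj := by
    cases c <;> constructor <;> simp only [cornerProfile, armDist] <;> omega
  arm_bottom s' i j hj := by
    cases c <;> constructor <;> simp only [cornerProfile, anchorDist, armDist] <;> omega
  spoke c' i := by
    have := y_pos (n := n) (by omega)
    cases c <;> cases c' <;> constructor <;>
      simp only [cornerProfile, anchorDist, lineDist] <;> omega
  edge i j hij e := by
    obtain ⟨h, hy, hh⟩ := exists_half_y hn
    have h1 := edgeLen_add hij hy
    have h2 := mul_y_add_le (n := n) (Fin.lt_def.1 hij)
    have h3 := mul_y_le j
    cases c <;> cases s <;> constructor <;> constructor <;>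
      simp only [cornerProfile, armDist, lineDist, endDist] <;> omega

theorem cornerProfile_exists_ext_lt_line (hn : 2 ≤ n) (b₀ : Bool) (c : Row) (s : Side)
    (c' : Row) (p : ℕ) (hp : p ≤ (n - 1) * y n) :
    ∃ u : Vertex H, (reduction H).Adj u (.line c' p hp) ∧
      (cornerProfile n b₀ c s).ext u < (cornerProfile n b₀ c s).ext (.line c' p hp : Vertex H) := by
  have hy : 1 < y n := by simp only [y]; nlinarith
  cases s with
  | left =>
    rcases Nat.eq_zero_or_pos p with rfl | hp0
    · cases c <;> cases c'
      · exact ⟨_, (Step.mid_left .top hp).adj, by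
          simp [Profile.ext, cornerProfile, lineDist, endDist]⟩
      -- At the end of the other line, the way back to the corner goes through the outermost vertex
      -- gadget, whose spoke is attached there.
      · exact ⟨_, (Step.spoke_line .bottom ⟨0, by omega⟩ (y n - 1) ⟨by omega, by omega⟩ 0 hp
          (by omega) (by simp)).adj, by
          simp only [Profile.ext, cornerProfile, lineDist, endDist, anchorDist]; omega⟩
      · exact ⟨_, (Step.spoke_line .top ⟨0, by omega⟩ (y n - 1) ⟨by omega, by omega⟩ 0 hp
          (by omega) (by simp)).adj, by
          simp only [Profile.ext, cornerProfile, lineDist, endDist, anchorDist]; omega⟩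
      · exact ⟨_, (Step.mid_left .bottom hp).adj, by
          simp [Profile.ext, cornerProfile, lineDist, endDist]⟩
    · obtain ⟨p, rfl⟩ : ∃ p', p = p' + 1 := ⟨p - 1, by omega⟩
      exact ⟨_, (Step.line_line c' p (by omega) hp).adj, by
        simp only [Profile.ext, cornerProfile, endDist]; omega⟩
  | right =>
    rcases Nat.eq_or_lt_of_le hp with rfl | hp0
    · cases c <;> cases c'
      · exact ⟨_, (Step.mid_right .top hp).adj, by
          simp [Profile.ext, cornerProfile, lineDist, endDist]⟩
      · exact ⟨_, (Step.spoke_line .bottom ⟨n - 1, by omega⟩ (y n - 1) ⟨by omega, by omega⟩ _ hp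
          (by omega) rfl).adj, by
          simp only [Profile.ext, cornerProfile, lineDist, endDist, anchorDist]; omega⟩
      · exact ⟨_, (Step.spoke_line .top ⟨n - 1, by omega⟩ (y n - 1) ⟨by omega, by omega⟩ _ hp
          (by omega) rfl).adj, by
          simp only [Profile.ext, cornerProfile, lineDist, endDist, anchorDist]; omega⟩
      · exact ⟨_, (Step.mid_right .bottom hp).adj, by
          simp [Profile.ext, cornerProfile, lineDist, endDist]⟩
    · exact ⟨_, (Step.line_line c' p hp hp0).adj.symm, by
        simp only [Profile.ext, cornerProfile, endDist]; omega⟩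

theorem cornerProfile_exists_ext_lt_mid (b₀ : Bool) (c : Row) (s : Side)
    (c' : Row) (s' : Side) :
    ∃ u : Vertex H, (reduction H).Adj u (.pendMid c' s') ∧
      (cornerProfile n b₀ c s).ext u < (cornerProfile n b₀ c s).ext (.pendMid c' s' : Vertex H) := by
  have h1 : ∀ u : Vertex H, u = .pendLeaf c' s' b₀ ∨ u = .line c' (endPos n s')
      (by cases s' <;> simp [endPos]) → (reduction H).Adj u (.pendMid c' s') := by
    rintro u (rfl | rfl)
    · exact (Step.leaf_mid c' s' b₀).adj
    · cases s'
      · exact (Step.mid_left c' _).adj.symm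
      · exact (Step.mid_right c' _).adj.symm
  by_cases hcs : c = c' ∧ s = s'
  · obtain ⟨rfl, rfl⟩ := hcs
    refine ⟨_, h1 _ (Or.inl rfl), ?_⟩
    cases c <;> cases s <;> simp [Profile.ext, cornerProfile]
  · refine ⟨_, h1 _ (Or.inr rfl), ?_⟩
    cases c <;> cases s <;> cases c' <;> cases s' <;> first
      | exact absurd ⟨rfl, rfl⟩ hcs
      | exact Nat.lt_succ_self _

theorem cornerProfile_exists_ext_lt_leaf (b₀ : Bool) (c : Row) (s : Side) (c' : Row) (s' : Side)
    (b : Bool) (hcs : ¬(c = c' ∧ s = s' ∧ b = b₀)) :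
    ∃ u : Vertex H, (reduction H).Adj u (.pendLeaf c' s' b) ∧
      (cornerProfile n b₀ c s).ext u <
        (cornerProfile n b₀ c s).ext (.pendLeaf c' s' b : Vertex H) := by
  refine ⟨_, (Step.leaf_mid c' s' b).adj.symm, ?_⟩
  cases c <;> cases s <;> cases c' <;> cases s' <;> first
    | exact Nat.lt_succ_self _
    | (have hb : b ≠ b₀ := fun h => hcs ⟨rfl, rfl, h⟩
       simp [Profile.ext, cornerProfile, hb])

theorem cornerProfile_exists_ext_lt_anchor (hn : 2 ≤ n) (b₀ : Bool) (c : Row) (s : Side)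
    (c' : Row) (i : Fin n) :
    ∃ u : Vertex H, (reduction H).Adj u (.anchor c' i) ∧
      (cornerProfile n b₀ c s).ext u < (cornerProfile n b₀ c s).ext (.anchor c' i : Vertex H) := by
  have hy : 1 < y n := by simp only [y]; nlinarith
  cases c <;> cases c'
  · exact ⟨_, (Step.anchor_spoke .top i ⟨by omega, hy⟩).adj.symm, by
      simp only [Profile.ext, cornerProfile, lineDist, anchorDist]; omega⟩
  · exact ⟨_, (Step.arm_bottom .right i ⟨n - 1, by omega⟩ (by simp; omega)).adj, by
      simp only [Profile.ext, cornerProfile, anchorDist, armDist]; omega⟩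
  · exact ⟨_, (Step.top_arm .right i ⟨0, by omega⟩ rfl).adj.symm, by
      simp only [Profile.ext, cornerProfile, anchorDist, armDist]; omega⟩
  · exact ⟨_, (Step.anchor_spoke .bottom i ⟨by omega, hy⟩).adj.symm, by
      simp only [Profile.ext, cornerProfile, lineDist, anchorDist]; omega⟩

theorem cornerProfile_exists_ext_lt_arm (b₀ : Bool) (c : Row) (s : Side)
    (s' : Side) (i j : Fin n) :
    ∃ u : Vertex H, (reduction H).Adj u (.arm s' i j) ∧
      (cornerProfile n b₀ c s).ext u < (cornerProfile n b₀ c s).ext (.arm s' i j : Vertex H) := by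
  cases c
  · by_cases hj : j.val = 0
    · exact ⟨_, (Step.top_arm s' i j hj).adj, by
        simp only [Profile.ext, cornerProfile, anchorDist, armDist]; omega⟩
    · exact ⟨_, (Step.arm_arm s' i ⟨j.val - 1, by omega⟩ j (by simp; omega)).adj, by
        simp only [Profile.ext, cornerProfile, armDist]; omega⟩
  · by_cases hj : j.val + 1 = n
    · exact ⟨_, (Step.arm_bottom s' i j hj).adj.symm, by
        simp only [Profile.ext, cornerProfile, anchorDist, armDist]; omega⟩
    · exact ⟨_, (Step.arm_arm s' i j ⟨j.val + 1, by omega⟩ rfl).adj.symm, by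
        simp only [Profile.ext, cornerProfile, armDist]; omega⟩

theorem edist_corner (hn : 2 ≤ n) (b₀ : Bool) (c : Row) (s : Side) (v : Vertex H) :
    (reduction H).edist (.pendLeaf c s b₀) v = (cornerProfile n b₀ c s).ext v := by
  have h0 : (cornerProfile n b₀ c s).ext (.pendLeaf c s b₀ : Vertex H) = 0 := by
    cases c <;> cases s <;> simp [Profile.ext, cornerProfile]
  apply le_antisymm
  · refine edist_le_of_descent (S := Set.univ) (fun v _ => ?_) (Set.mem_univ v)
    simp only [Set.mem_univ, true_and]
    cases v with
    | line c' p hp => exact Or.inr (cornerProfile_exists_ext_lt_line hn b₀ c s c' p hp)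
    | pendMid c' s' => exact Or.inr (cornerProfile_exists_ext_lt_mid b₀ c s c' s')
    | pendLeaf c' s' b =>
      by_cases hcs : c = c' ∧ s = s' ∧ b = b₀
      · obtain ⟨rfl, rfl, rfl⟩ := hcs
        exact Or.inl rfl
      · exact Or.inr (cornerProfile_exists_ext_lt_leaf b₀ c s c' s' b hcs)
    | anchor c' i => exact Or.inr (cornerProfile_exists_ext_lt_anchor hn b₀ c s c' i)
    | arm s' i j => exact Or.inr (cornerProfile_exists_ext_lt_arm b₀ c s s' i j)
    | spoke c' i k hk => exact Or.inr (Profile.exists_ext_lt_spoke _ c' i k hk)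
    | edgePath i j hij e k hk => exact Or.inr (Profile.exists_ext_lt_edgePath _ i j hij e k hk)
    | branch s' i j hij e k hk => exact Or.inr (Profile.exists_ext_lt_branch _ s' i j hij e k hk)
  · have := le_edist_of_lipschitz (cornerProfile_isLipschitz (H := H) hn b₀ c s).ext_le v
      (.pendLeaf c s b₀)
    rwa [h0, Nat.cast_zero, zero_add, SimpleGraph.edist_comm] at this

end MetricDim

namespace MetricDim

/-! ### Comparing corner distances in edge gadgets: linear arithmetic -/

/-- The distances from the four corners (each diminished by `2`) to the vertex at position
`k ≤ 2 * h` of an edge path, in terms of the near end; the near corners come first. -/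
structure EndDists (n h N X a b k t₁ t₂ t₃ t₄ : ℤ) : Prop where
  pos : 0 < k
  le : k ≤ 2 * h
  d₁ : t₁ = X + 2 * h + 1 + b + min k (2 * h - k)
  d₂ : t₂ + X = N + min (2 * h + 1 + b + k) (3 * h + a + 1 - k)
  d₃ : t₃ = X + 2 * h + n - b + k
  d₄ : t₄ + X = N + min (2 * h + n - b + k) (5 * h + n - a - k)

/-- The analogue of `EndDists` for the inner part of an edge path. -/
structure MidDists (n h N X a b k t₁ t₂ t₃ t₄ : ℤ) : Prop where
  le : 2 * h ≤ k
  d₁ : t₁ = X + 1 + b + k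
  d₂ : t₂ + k + X = N + 3 * h + a + 1
  d₃ : t₃ = X + 2 * h + n - b + k
  d₄ : t₄ + k + X = N + 5 * h + n - a

/-- The analogue of `EndDists` for a branch. -/
structure BranchDists (n h N X a b k t₁ t₂ t₃ t₄ : ℤ) : Prop where
  pos : 0 < k
  lt : k < 2 * h
  d₁ : t₁ + k = X + 1 + b + 2 * h
  d₂ : t₂ + X + b + 1 + k = N + min (2 * h) (h + a + b + 2 + 2 * k)
  d₃ : t₃ = X + min (4 * h + n - b + k) (6 * h + n + b + 2 - k)
  d₄ : t₄ + X = N + min (3 * h + n - a + k) (6 * h + n - b - k)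

/-- `X` and `X'` agree if `a` and `a'` do, and otherwise they are at least `2 * h` apart. -/
def Separated (h a a' X X' : ℤ) : Prop :=
  (a = a' ∧ X = X') ∨ (a ≠ a' ∧ (X + 2 * h ≤ X' ∨ X' + 2 * h ≤ X))

section
variable {n h N X X' a b k a' b' k' t₁ t₂ t₃ t₄ : ℤ}

/-- The three minima switch at `2k = h + a - b`, `k = h` and `2k = 3h + b - a`, in this order
because `a` and `b` are small against `h`. Between the switches all four distances are affine, so a
comparison of two vertices splits into linear systems. -/
theorem EndDists.zones (hh : 10 * n ≤ h) (ha : 0 ≤ a ∧ a < n) (hb : 0 ≤ b ∧ b < n)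
    (hv : EndDists n h N X a b k t₁ t₂ t₃ t₄) :
    (2 * k + b ≤ h + a ∧ t₁ = X + 2 * h + 1 + b + k ∧ t₂ + X = N + 2 * h + 1 + b + k ∧
      t₃ + b = X + 2 * h + n + k ∧ t₄ + X + b = N + 2 * h + n + k) ∨
    (h + a ≤ 2 * k + b ∧ k ≤ h ∧ t₁ = X + 2 * h + 1 + b + k ∧ t₂ + X + k = N + 3 * h + a + 1 ∧
      t₃ + b = X + 2 * h + n + k ∧ t₄ + X + b = N + 2 * h + n + k) ∨
    (h ≤ k ∧ 2 * k + a ≤ 3 * h + b ∧ t₁ + k = X + 4 * h + 1 + b ∧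
      t₂ + X + k = N + 3 * h + a + 1 ∧
      t₃ + b = X + 2 * h + n + k ∧ t₄ + X + b = N + 2 * h + n + k) ∨
    (3 * h + b ≤ 2 * k + a ∧ k ≤ 2 * h ∧ t₁ + k = X + 4 * h + 1 + b ∧
      t₂ + X + k = N + 3 * h + a + 1 ∧
      t₃ + b = X + 2 * h + n + k ∧ t₄ + X + a + k = N + 5 * h + n) := by
  obtain ⟨p1, p2, p3, p4, p5, p6⟩ := hv
  rcases le_total (2 * k + b) (h + a) with h1 | h1
  · rw [min_eq_left (by omega)] at p3 p4 p6
    exact Or.inl ⟨h1, by omega, by omega, by omega, by omega⟩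
  rw [min_eq_right (by omega)] at p4
  rcases le_total k h with h2 | h2
  · rw [min_eq_left (by omega)] at p3 p6
    exact Or.inr (Or.inl ⟨h1, h2, by omega, by omega, by omega, by omega⟩)
  rw [min_eq_right (by omega)] at p3
  rcases le_total (2 * k + a) (3 * h + b) with h3 | h3
  · rw [min_eq_left (by omega)] at p6
    exact Or.inr (Or.inr (Or.inl ⟨h2, h3, by omega, by omega, by omega, by omega⟩))
  · rw [min_eq_right (by omega)] at p6
    exact Or.inr (Or.inr (Or.inr ⟨h3, p2, by omega, by omega, by omega, by omega⟩))

theorem BranchDists.zones (hh : 10 * n ≤ h) (ha : 0 ≤ a ∧ a < n) (hb : 0 ≤ b ∧ b < n)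
    (hv : BranchDists n h N X a b k t₁ t₂ t₃ t₄) :
    (2 * k + a + b + 2 ≤ h ∧ t₂ + X = N + h + a + 1 + k ∧ t₃ + b = X + 4 * h + n + k ∧
      t₄ + X + a = N + 3 * h + n + k) ∨
    (h ≤ 2 * k + a + b + 2 ∧ k ≤ h + b + 1 ∧ t₂ + X + b + 1 + k = N + 2 * h ∧
      t₃ + b = X + 4 * h + n + k ∧ t₄ + X + a = N + 3 * h + n + k) ∨
    (h + b + 1 ≤ k ∧ 2 * k + b ≤ 3 * h + a ∧ t₂ + X + b + 1 + k = N + 2 * h ∧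
      t₃ + k = X + 6 * h + n + b + 2 ∧ t₄ + X + a = N + 3 * h + n + k) ∨
    (3 * h + a ≤ 2 * k + b ∧ t₂ + X + b + 1 + k = N + 2 * h ∧
      t₃ + k = X + 6 * h + n + b + 2 ∧ t₄ + X + b + k = N + 6 * h + n) := by
  obtain ⟨p1, p2, p3, p4, p5, p6⟩ := hv
  rcases le_total (2 * k + a + b + 2) h with h1 | h1
  · rw [min_eq_right (by omega)] at p4
    rw [min_eq_left (by omega)] at p5 p6
    exact Or.inl ⟨h1, by omega, by omega, by omega⟩
  rw [min_eq_left (by omega)] at p4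
  rcases le_total k (h + b + 1) with h2 | h2
  · rw [min_eq_left (by omega)] at p5 p6
    exact Or.inr (Or.inl ⟨h1, h2, by omega, by omega, by omega⟩)
  rw [min_eq_right (by omega)] at p5
  rcases le_total (2 * k + b) (3 * h + a) with h3 | h3
  · rw [min_eq_left (by omega)] at p6
    exact Or.inr (Or.inr (Or.inl ⟨h2, h3, by omega, by omega, by omega⟩))
  · rw [min_eq_right (by omega)] at p6
    exact Or.inr (Or.inr (Or.inr ⟨h3, by omega, by omega, by omega⟩))

/-- Equal columns or columns at least `2 * h` apart, times a zone for each vertex: every resulting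
linear system is contradictory or forces equality. -/
theorem EndDists.eq_of_end (hh : 10 * n ≤ h) (ha : 0 ≤ a ∧ a < n) (hb : 0 ≤ b ∧ b < n)
    (ha' : 0 ≤ a' ∧ a' < n) (hb' : 0 ≤ b' ∧ b' < n) (hX : Separated h a a' X X')
    (hv : EndDists n h N X a b k t₁ t₂ t₃ t₄) (hw : EndDists n h N X' a' b' k' t₁ t₂ t₃ t₄) :
    a = a' ∧ b = b' ∧ k = k' := by
  have _ := hv.pos
  have _ := hv.le
  replace hv := hv.zones hh ha hb
  have _ := hw.pos
  have _ := hw.le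
  replace hw := hw.zones hh ha' hb'
  obtain ⟨ha, ha2⟩ := ha
  obtain ⟨ha', ha2'⟩ := ha'
  obtain ⟨hb, hb2⟩ := hb
  obtain ⟨hb', hb2'⟩ := hb'
  rcases hX with ⟨rfl, hX⟩ | ⟨-, hX | hX⟩ <;>
  rcases hv with ⟨_, _, _, _, _⟩ | ⟨_, _, _, _, _, _⟩ | ⟨_, _, _, _, _, _⟩ | ⟨_, _, _, _, _, _⟩ <;>
  rcases hw with ⟨_, _, _, _, _⟩ | ⟨_, _, _, _, _, _⟩ | ⟨_, _, _, _, _, _⟩ | ⟨_, _, _, _, _, _⟩ <;>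
  first
    | (exfalso; linarith)
    | exact ⟨by linarith, by linarith, by linarith⟩

theorem EndDists.eq_of_mid (hh : 10 * n ≤ h) (ha : 0 ≤ a ∧ a < n) (hb : 0 ≤ b ∧ b < n)
    (ha' : 0 ≤ a' ∧ a' < n) (hb' : 0 ≤ b' ∧ b' < n) (hX : Separated h a a' X X')
    (hv : EndDists n h N X a b k t₁ t₂ t₃ t₄) (hw : MidDists n h N X' a' b' k' t₁ t₂ t₃ t₄) :
    a = a' ∧ b = b' ∧ k = k' := by
  have _ := hv.pos
  have _ := hv.le
  replace hv := hv.zones hh ha hb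
  obtain ⟨_, _, _, _, _⟩ := hw
  obtain ⟨ha, ha2⟩ := ha
  obtain ⟨ha', ha2'⟩ := ha'
  obtain ⟨hb, hb2⟩ := hb
  obtain ⟨hb', hb2'⟩ := hb'
  rcases hX with ⟨rfl, hX⟩ | ⟨hne, hX | hX⟩ <;>
  rcases hv with ⟨_, _, _, _, _⟩ | ⟨_, _, _, _, _, _⟩ | ⟨_, _, _, _, _, _⟩ | ⟨_, _, _, _, _, _⟩ <;>
  first
    | (exfalso; linarith)
    | exact ⟨by linarith, by linarith, by linarith⟩
    | exact absurd (by linarith) hne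

/-- These collisions do occur. Both vertices lie `k'` steps from their branching point, whose
distances from the far corners do not depend on `b`, and they are reached from those corners through
it. From the near corners, the shift of `b` by `2 * k'` balances the fact that one vertex lies
before the branching point and the other beyond it. -/
theorem EndDists.exceptional_of_branch (hh : 10 * n ≤ h) (ha : 0 ≤ a ∧ a < n) (hb : 0 ≤ b ∧ b < n)
    (ha' : 0 ≤ a' ∧ a' < n) (hb' : 0 ≤ b' ∧ b' < n) (hX : Separated h a a' X X')
    (hv : EndDists n h N X a b k t₁ t₂ t₃ t₄) (hw : BranchDists n h N X' a' b' k' t₁ t₂ t₃ t₄) :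
    a = a' ∧ b' = b + 2 * k' ∧ k + k' = 2 * h := by
  have _ := hv.pos
  have _ := hv.le
  replace hv := hv.zones hh ha hb
  have _ := hw.pos
  have _ := hw.lt
  have _ := hw.d₁
  replace hw := hw.zones hh ha' hb'
  obtain ⟨ha, ha2⟩ := ha
  obtain ⟨ha', ha2'⟩ := ha'
  obtain ⟨hb, hb2⟩ := hb
  obtain ⟨hb', hb2'⟩ := hb'
  rcases hX with ⟨rfl, hX⟩ | ⟨-, hX | hX⟩ <;>
  rcases hv with ⟨_, _, _, _, _⟩ | ⟨_, _, _, _, _, _⟩ | ⟨_, _, _, _, _, _⟩ | ⟨_, _, _, _, _, _⟩ <;>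
  rcases hw with ⟨_, _, _, _⟩ | ⟨_, _, _, _, _⟩ | ⟨_, _, _, _, _⟩ | ⟨_, _, _, _⟩ <;>
  first
    | (exfalso; linarith)
    | exact ⟨by linarith, by linarith, by linarith⟩

theorem MidDists.eq_of_mid (ha : 0 ≤ a ∧ a < n) (hb : 0 ≤ b ∧ b < n)
    (ha' : 0 ≤ a' ∧ a' < n) (hb' : 0 ≤ b' ∧ b' < n) (hX : Separated h a a' X X')
    (hv : MidDists n h N X a b k t₁ t₂ t₃ t₄) (hw : MidDists n h N X' a' b' k' t₁ t₂ t₃ t₄) :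
    a = a' ∧ b = b' ∧ k = k' := by
  obtain ⟨_, _, _, _, _⟩ := hv
  obtain ⟨_, _, _, _, _⟩ := hw
  obtain ⟨ha, ha2⟩ := ha
  obtain ⟨ha', ha2'⟩ := ha'
  obtain ⟨hb, hb2⟩ := hb
  obtain ⟨hb', hb2'⟩ := hb'
  rcases hX with ⟨rfl, hX⟩ | ⟨hne, hX | hX⟩ <;>
  first
    | exact ⟨by linarith, by linarith, by linarith⟩
    | exact absurd (by linarith) hne

theorem MidDists.not_branch (hh : 10 * n ≤ h) (ha : 0 ≤ a ∧ a < n) (hb : 0 ≤ b ∧ b < n)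
    (ha' : 0 ≤ a' ∧ a' < n) (hb' : 0 ≤ b' ∧ b' < n) (hX : Separated h a a' X X')
    (hv : MidDists n h N X a b k t₁ t₂ t₃ t₄) (hw : BranchDists n h N X' a' b' k' t₁ t₂ t₃ t₄) :
    False := by
  obtain ⟨_, _, _, _, _⟩ := hv
  have _ := hw.pos
  have _ := hw.lt
  have _ := hw.d₁
  replace hw := hw.zones hh ha' hb'
  obtain ⟨ha, ha2⟩ := ha
  obtain ⟨ha', ha2'⟩ := ha'
  obtain ⟨hb, hb2⟩ := hb
  obtain ⟨hb', hb2'⟩ := hb'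
  rcases hX with ⟨rfl, hX⟩ | ⟨-, hX | hX⟩ <;>
  rcases hw with ⟨_, _, _, _⟩ | ⟨_, _, _, _, _⟩ | ⟨_, _, _, _, _⟩ | ⟨_, _, _, _⟩ <;>
  linarith

theorem BranchDists.eq_of_branch (hh : 10 * n ≤ h) (ha : 0 ≤ a ∧ a < n) (hb : 0 ≤ b ∧ b < n)
    (ha' : 0 ≤ a' ∧ a' < n) (hb' : 0 ≤ b' ∧ b' < n) (hX : Separated h a a' X X')
    (hv : BranchDists n h N X a b k t₁ t₂ t₃ t₄) (hw : BranchDists n h N X' a' b' k' t₁ t₂ t₃ t₄) :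
    a = a' ∧ b = b' ∧ k = k' := by
  have _ := hv.pos
  have _ := hv.lt
  have _ := hv.d₁
  replace hv := hv.zones hh ha hb
  have _ := hw.pos
  have _ := hw.lt
  have _ := hw.d₁
  replace hw := hw.zones hh ha' hb'
  obtain ⟨ha, ha2⟩ := ha
  obtain ⟨ha', ha2'⟩ := ha'
  obtain ⟨hb, hb2⟩ := hb
  obtain ⟨hb', hb2'⟩ := hb'
  rcases hX with ⟨rfl, hX⟩ | ⟨-, hX | hX⟩ <;>
  rcases hv with ⟨_, _, _, _⟩ | ⟨_, _, _, _, _⟩ | ⟨_, _, _, _, _⟩ | ⟨_, _, _, _⟩ <;>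
  rcases hw with ⟨_, _, _, _⟩ | ⟨_, _, _, _, _⟩ | ⟨_, _, _, _, _⟩ | ⟨_, _, _, _⟩ <;>
  first
    | (exfalso; linarith)
    | exact ⟨by linarith, by linarith, by linarith⟩

/-- The second vertex is described from the right: its distances come in exchanged order, and its
column counted from the left is `N - X'`. The conclusion exchanges the two ends, which is impossible
once both edges are written in increasing order. -/
theorem EndDists.eq_of_end_mirror (hh : 10 * n ≤ h) (ha : 0 ≤ a ∧ a < n) (hb : 0 ≤ b ∧ b < n)
    (ha' : 0 ≤ a' ∧ a' < n) (hb' : 0 ≤ b' ∧ b' < n) (hX : Separated h a b' X (N - X'))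
    (hv : EndDists n h N X a b k t₁ t₂ t₃ t₄) (hw : EndDists n h N X' b' a' k' t₂ t₁ t₄ t₃) :
    a = b' ∧ b = a' := by
  have _ := hv.pos
  have _ := hv.le
  replace hv := hv.zones hh ha hb
  have _ := hw.pos
  have _ := hw.le
  replace hw := hw.zones hh hb' ha'
  obtain ⟨ha, ha2⟩ := ha
  obtain ⟨ha', ha2'⟩ := ha'
  obtain ⟨hb, hb2⟩ := hb
  obtain ⟨hb', hb2'⟩ := hb'
  rcases hX with ⟨rfl, hX⟩ | ⟨-, hX | hX⟩ <;>
  rcases hv with ⟨_, _, _, _, _⟩ | ⟨_, _, _, _, _, _⟩ | ⟨_, _, _, _, _, _⟩ | ⟨_, _, _, _, _, _⟩ <;>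
  rcases hw with ⟨_, _, _, _, _⟩ | ⟨_, _, _, _, _, _⟩ | ⟨_, _, _, _, _, _⟩ | ⟨_, _, _, _, _, _⟩ <;>
  first
    | (exfalso; linarith)
    | exact ⟨by linarith, by linarith⟩

/-- The value `k' = 2 * h` is the branching point, where the two ranges meet. -/
theorem MidDists.eq_of_end_mirror (hh : 10 * n ≤ h) (ha : 0 ≤ a ∧ a < n) (hb : 0 ≤ b ∧ b < n)
    (ha' : 0 ≤ a' ∧ a' < n) (hb' : 0 ≤ b' ∧ b' < n) (hX : Separated h a b' X (N - X'))
    (hv : MidDists n h N X a b k t₁ t₂ t₃ t₄) (hw : EndDists n h N X' b' a' k' t₂ t₁ t₄ t₃) :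
    a = a' ∧ b = b' ∧ k' = 2 * h := by
  obtain ⟨_, _, _, _, _⟩ := hv
  have _ := hw.pos
  have _ := hw.le
  replace hw := hw.zones hh hb' ha'
  obtain ⟨ha, ha2⟩ := ha
  obtain ⟨ha', ha2'⟩ := ha'
  obtain ⟨hb, hb2⟩ := hb
  obtain ⟨hb', hb2'⟩ := hb'
  rcases hX with ⟨rfl, hX⟩ | ⟨-, hX | hX⟩ <;>
  rcases hw with ⟨_, _, _, _, _⟩ | ⟨_, _, _, _, _, _⟩ | ⟨_, _, _, _, _, _⟩ | ⟨_, _, _, _, _, _⟩ <;>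
  first
    | (exfalso; linarith)
    | exact ⟨by linarith, by linarith, by linarith⟩

theorem EndDists.not_branch_mirror (hh : 10 * n ≤ h) (ha : 0 ≤ a ∧ a < n) (hb : 0 ≤ b ∧ b < n)
    (ha' : 0 ≤ a' ∧ a' < n) (hb' : 0 ≤ b' ∧ b' < n) (hX : Separated h a b' X (N - X'))
    (hv : EndDists n h N X a b k t₁ t₂ t₃ t₄) (hw : BranchDists n h N X' b' a' k' t₂ t₁ t₄ t₃) :
    False := by
  have _ := hv.pos
  have _ := hv.le
  replace hv := hv.zones hh ha hb
  have _ := hw.pos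
  have _ := hw.lt
  have _ := hw.d₁
  replace hw := hw.zones hh hb' ha'
  obtain ⟨ha, ha2⟩ := ha
  obtain ⟨ha', ha2'⟩ := ha'
  obtain ⟨hb, hb2⟩ := hb
  obtain ⟨hb', hb2'⟩ := hb'
  rcases hX with ⟨rfl, hX⟩ | ⟨-, hX | hX⟩ <;>
  rcases hv with ⟨_, _, _, _, _⟩ | ⟨_, _, _, _, _, _⟩ | ⟨_, _, _, _, _, _⟩ | ⟨_, _, _, _, _, _⟩ <;>
  rcases hw with ⟨_, _, _, _⟩ | ⟨_, _, _, _, _⟩ | ⟨_, _, _, _, _⟩ | ⟨_, _, _, _⟩ <;>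
  linarith

theorem MidDists.not_branch_mirror (hh : 10 * n ≤ h) (ha : 0 ≤ a ∧ a < n) (hb : 0 ≤ b ∧ b < n)
    (ha' : 0 ≤ a' ∧ a' < n) (hb' : 0 ≤ b' ∧ b' < n) (hX : Separated h a b' X (N - X'))
    (hv : MidDists n h N X a b k t₁ t₂ t₃ t₄) (hw : BranchDists n h N X' b' a' k' t₂ t₁ t₄ t₃) :
    False := by
  obtain ⟨_, _, _, _, _⟩ := hv
  have _ := hw.pos
  have _ := hw.lt
  have _ := hw.d₁
  replace hw := hw.zones hh hb' ha'
  obtain ⟨ha, ha2⟩ := ha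
  obtain ⟨ha', ha2'⟩ := ha'
  obtain ⟨hb, hb2⟩ := hb
  obtain ⟨hb', hb2'⟩ := hb'
  rcases hX with ⟨rfl, hX⟩ | ⟨-, hX | hX⟩ <;>
  rcases hw with ⟨_, _, _, _⟩ | ⟨_, _, _, _, _⟩ | ⟨_, _, _, _, _⟩ | ⟨_, _, _, _⟩ <;>
  linarith

theorem BranchDists.not_branch_mirror (hh : 10 * n ≤ h) (ha : 0 ≤ a ∧ a < n) (hb : 0 ≤ b ∧ b < n)
    (ha' : 0 ≤ a' ∧ a' < n) (hb' : 0 ≤ b' ∧ b' < n) (hX : Separated h a b' X (N - X'))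
    (hv : BranchDists n h N X a b k t₁ t₂ t₃ t₄) (hw : BranchDists n h N X' b' a' k' t₂ t₁ t₄ t₃) :
    False := by
  have _ := hv.pos
  have _ := hv.lt
  have _ := hv.d₁
  replace hv := hv.zones hh ha hb
  have _ := hw.pos
  have _ := hw.lt
  have _ := hw.d₁
  replace hw := hw.zones hh hb' ha'
  obtain ⟨ha, ha2⟩ := ha
  obtain ⟨ha', ha2'⟩ := ha'
  obtain ⟨hb, hb2⟩ := hb
  obtain ⟨hb', hb2'⟩ := hb'
  rcases hX with ⟨rfl, hX⟩ | ⟨-, hX | hX⟩ <;>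
  rcases hv with ⟨_, _, _, _⟩ | ⟨_, _, _, _, _⟩ | ⟨_, _, _, _, _⟩ | ⟨_, _, _, _⟩ <;>
  rcases hw with ⟨_, _, _, _⟩ | ⟨_, _, _, _, _⟩ | ⟨_, _, _, _, _⟩ | ⟨_, _, _, _⟩ <;>
  linarith

end

end MetricDim

namespace MetricDim

variable {n : ℕ} {H : SimpleGraph (Fin n)}

/-! ### The corner distances of edge paths and branches, and their collisions -/

/-- The distance from the corner at the end `s` of line `c`, diminished by `2`. -/
def cornerDist (β : Row → Side → Bool) (c : Row) (s : Side) (v : Vertex H) : ℤ :=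
  ((cornerProfile n (β c s) c s).ext v : ℤ) - 2

theorem edgeVal_eq {Y L A B C D k m : ℕ} (h₁ : m ≤ A + k) (h₂ : m ≤ B + (L - k))
    (h₃ : m ≤ C + Y + ((k - Y) + (Y - k))) (h₄ : m ≤ D + Y + ((k + Y - L) + (L - (k + Y))))
    (h₅ : m = A + k ∨ m = B + (L - k) ∨ m = C + Y + ((k - Y) + (Y - k)) ∨
      m = D + Y + ((k + Y - L) + (L - (k + Y)))) : edgeVal Y L A B C D k = m := by
  refine le_antisymm ?_ (le_min (le_min h₁ h₂) (le_min h₃ h₄))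
  simp only [edgeVal, min_le_iff]
  omega

theorem cast_min_eq {u v : ℕ} {c p q : ℤ} (hp : (u : ℤ) = c + p) (hq : (v : ℤ) = c + q) :
    ((min u v : ℕ) : ℤ) = c + min p q := by
  rw [Nat.cast_min, hp, hq, min_add_add_left]

theorem edgeVal_symm {Y L A B C D k : ℕ} (hk : k ≤ L) :
    edgeVal Y L A B C D k = edgeVal Y L B A D C (L - k) := by
  have h1 : L - (L - k) = k := by omega
  have h2 : (k - Y) + (Y - k) = (L - k + Y - L) + (L - (L - k + Y)) := by omega
  have h3 : (k + Y - L) + (L - (k + Y)) = (L - k - Y) + (Y - (L - k)) := by omega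
  rw [edgeVal, edgeVal, h1, h2, h3, min_comm (A + k), min_comm (C + _ + _)]

section
variable {h a b G X k : ℕ}

/-- Each of the following evaluations names the terminal through which the corner is reached. Near
top: the own arm up to `k = h`, then the near foot. Far top: the own arm, then the far foot. Far
bottom: the own arm, then the arm at the other end. In the middle: the near foot for the top corner,
the own arm for the bottom one. -/
theorem edgeVal_near_top (hh : 10 * n ≤ h) (ha : a < n) (hb : b < n) (hG : 2 * h ≤ G)
    (hk : k ≤ 2 * h) :
    edgeVal (2 * h) (G + 3 * h) (X + 2 * h + 1 + b) (X + G + 2 * h + 1 + a) (X + b + 1)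
      (X + G - (a + 1)) k = X + 2 * h + 1 + b + min k (2 * h - k) := by
  rcases le_total k h with h1 | h1
  · rw [min_eq_left (by omega)]
    exact edgeVal_eq (by omega) (by omega) (by omega) (by omega) (Or.inl (by omega))
  · rw [min_eq_right (by omega)]
    exact edgeVal_eq (by omega) (by omega) (by omega) (by omega)
      (Or.inr (Or.inr (Or.inl (by omega))))

theorem edgeVal_far_top (hh : 10 * n ≤ h) (ha : a < n) (hb : b < n) (hG : 2 * h ≤ G)
    (hk : k ≤ 2 * h) :
    edgeVal (2 * h) (G + 3 * h) (X + G + 2 * h + 1 + b) (X + 2 * h + 1 + a) (X + G - (b + 1))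
      (X + a + 1) k = X + G + min (2 * h + 1 + b + k) (3 * h + a + 1 - k) := by
  rcases le_total (2 * h + 1 + b + k) (3 * h + a + 1 - k) with h1 | h1
  · rw [min_eq_left h1]
    exact edgeVal_eq (by omega) (by omega) (by omega) (by omega) (Or.inl (by omega))
  · rw [min_eq_right h1]
    exact edgeVal_eq (by omega) (by omega) (by omega) (by omega)
      (Or.inr (Or.inr (Or.inr (by omega))))

theorem edgeVal_far_bottom (hh : 10 * n ≤ h) (ha : a < n) (hb : b < n)
    (hk : k ≤ 2 * h) :
    edgeVal (2 * h) (G + 3 * h) (X + G + 2 * h + n - b) (X + 2 * h + n - a)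
      (X + G - (b + 1) + (4 * h + n + 1)) (X + a + 1 + (4 * h + n + 1)) k =
        X + G + min (2 * h + n - b + k) (5 * h + n - a - k) := by
  rcases le_total (2 * h + n - b + k) (5 * h + n - a - k) with h1 | h1
  · rw [min_eq_left h1]
    exact edgeVal_eq (by omega) (by omega) (by omega) (by omega) (Or.inl (by omega))
  · rw [min_eq_right h1]
    exact edgeVal_eq (by omega) (by omega) (by omega) (by omega) (Or.inr (Or.inl (by omega)))

theorem edgeVal_mid_top (hh : 10 * n ≤ h) (ha : a < n) (hb : b < n)
    (hk : 2 * h ≤ k) (hk' : k ≤ G + h) :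
    edgeVal (2 * h) (G + 3 * h) (X + 2 * h + 1 + b) (X + G + 2 * h + 1 + a) (X + b + 1)
      (X + G - (a + 1)) k = X + 1 + b + k :=
  edgeVal_eq (by omega) (by omega) (by omega) (by omega) (Or.inr (Or.inr (Or.inl (by omega))))

theorem edgeVal_mid_bottom (hh : 10 * n ≤ h) (ha : a < n) (hb : b < n) (hG : 2 * h ≤ G)
    (hk' : k ≤ G + h) :
    edgeVal (2 * h) (G + 3 * h) (X + 2 * h + n - b) (X + G + 2 * h + n - a)
      (X + b + 1 + (4 * h + n + 1)) (X + G - (a + 1) + (4 * h + n + 1)) k =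
        X + 2 * h + n - b + k :=
  edgeVal_eq (by omega) (by omega) (by omega) (by omega) (Or.inl (by omega))

end

/-- The values of the corner profiles along an edge path, in a form free of products. -/
theorem cornerProfile_edge {h : ℕ} (hy : y n = 2 * h) (hh : 10 * n ≤ h) {a b : Fin n}
    (hab : a < b) : ∃ G W, 2 * h ≤ G ∧ edgeLen a b = G + 3 * h ∧
      b.val * y n = a.val * y n + G ∧ (n - 1) * y n = a.val * y n + G + W ∧ ∀ b₀ k,
      (cornerProfile n b₀ .top .left).edge a b k = edgeVal (2 * h) (G + 3 * h)
        (2 + a.val * y n + 2 * h + 1 + b) (2 + a.val * y n + G + 2 * h + 1 + a)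
        (2 + a.val * y n + b + 1) (2 + a.val * y n + G - (a + 1)) k ∧
      (cornerProfile n b₀ .top .right).edge a b k = edgeVal (2 * h) (G + 3 * h)
        (2 + W + G + 2 * h + 1 + b) (2 + W + 2 * h + 1 + a)
        (2 + W + G - (b + 1)) (2 + W + a + 1) k ∧
      (cornerProfile n b₀ .bottom .left).edge a b k = edgeVal (2 * h) (G + 3 * h)
        (2 + a.val * y n + 2 * h + n - b) (2 + a.val * y n + G + 2 * h + n - a)
        (2 + a.val * y n + b + 1 + (4 * h + n + 1))
        (2 + a.val * y n + G - (a + 1) + (4 * h + n + 1)) k ∧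
      (cornerProfile n b₀ .bottom .right).edge a b k = edgeVal (2 * h) (G + 3 * h)
        (2 + W + G + 2 * h + n - b) (2 + W + 2 * h + n - a)
        (2 + W + G - (b + 1) + (4 * h + n + 1)) (2 + W + a + 1 + (4 * h + n + 1)) k := by
  have h1 := edgeLen_add hab hy
  have h2 := mul_y_add_le (n := n) (Fin.lt_def.1 hab)
  have h3 := mul_y_le b
  -- `G` is the distance of the two columns and `W` the rest of the line to the right of them.
  refine ⟨b.val * y n - a.val * y n, (n - 1) * y n - b.val * y n, by omega, by omega, by omega,
    by omega, fun b₀ k => ?_⟩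
  simp only [Profile.edge, cornerProfile, armDist, lineDist, endDist]
  refine ⟨?_, ?_, ?_, ?_⟩ <;> congr 1 <;> omega

theorem endDists_left {h : ℕ} (hy : y n = 2 * h) (hh : 10 * n ≤ h) (β : Row → Side → Bool)
    {a b : Fin n} (hab : a < b) (e : H.Adj a b) {k : ℕ} (hk : 0 < k ∧ k < edgeLen a b)
    (hk2 : k ≤ y n) :
    EndDists n h ((n - 1) * y n : ℕ) (a.val * y n : ℕ) a b k
      (cornerDist β .top .left (.edgePath a b hab e k hk : Vertex H))
      (cornerDist β .top .right (.edgePath a b hab e k hk : Vertex H))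
      (cornerDist β .bottom .left (.edgePath a b hab e k hk : Vertex H))
      (cornerDist β .bottom .right (.edgePath a b hab e k hk : Vertex H)) := by
  obtain ⟨G, W, hG, hL, hJ, hN, hφ⟩ := cornerProfile_edge hy hh hab
  simp only [cornerDist, Profile.ext, (hφ _ _).1, (hφ _ _).2.1, (hφ _ _).2.2.1, (hφ _ _).2.2.2]
  rw [edgeVal_near_top hh a.isLt b.isLt hG (by omega),
    edgeVal_far_top hh a.isLt b.isLt hG (by omega),
    edgeVal_mid_bottom hh a.isLt b.isLt hG (by omega),
    edgeVal_far_bottom hh a.isLt b.isLt (by omega)]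
  constructor <;> omega

theorem midDists {h : ℕ} (hy : y n = 2 * h) (hh : 10 * n ≤ h) (β : Row → Side → Bool)
    {a b : Fin n} (hab : a < b) (e : H.Adj a b) {k : ℕ} (hk : 0 < k ∧ k < edgeLen a b)
    (hk2 : y n ≤ k) (hk3 : k + y n ≤ edgeLen a b) :
    MidDists n h ((n - 1) * y n : ℕ) (a.val * y n : ℕ) a b k
      (cornerDist β .top .left (.edgePath a b hab e k hk : Vertex H))
      (cornerDist β .top .right (.edgePath a b hab e k hk : Vertex H))
      (cornerDist β .bottom .left (.edgePath a b hab e k hk : Vertex H))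
      (cornerDist β .bottom .right (.edgePath a b hab e k hk : Vertex H)) := by
  obtain ⟨G, W, hG, hL, hJ, hN, hφ⟩ := cornerProfile_edge hy hh hab
  simp only [cornerDist, Profile.ext, (hφ _ _).1, (hφ _ _).2.1, (hφ _ _).2.2.1, (hφ _ _).2.2.2]
  rw [edgeVal_mid_top hh a.isLt b.isLt (by omega) (by omega),
    edgeVal_symm (k := k) (C := 2 + W + G - _) (by omega),
    edgeVal_mid_top hh b.isLt a.isLt (by omega) (by omega),
    edgeVal_mid_bottom hh a.isLt b.isLt hG (by omega), edgeVal_symm (k := k) (C := 2 + W + G - _ + _) (by omega),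
    edgeVal_mid_bottom hh b.isLt a.isLt hG (by omega)]
  constructor <;> omega

theorem endDists_right {h : ℕ} (hy : y n = 2 * h) (hh : 10 * n ≤ h) (β : Row → Side → Bool)
    {a b : Fin n} (hab : a < b) (e : H.Adj a b) {k : ℕ} (hk : 0 < k ∧ k < edgeLen a b)
    (hk2 : edgeLen a b ≤ k + y n) :
    EndDists n h ((n - 1) * y n : ℕ) ((n - 1) * y n - b.val * y n : ℕ) b a (edgeLen a b - k : ℕ)
      (cornerDist β .top .right (.edgePath a b hab e k hk : Vertex H))
      (cornerDist β .top .left (.edgePath a b hab e k hk : Vertex H))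
      (cornerDist β .bottom .right (.edgePath a b hab e k hk : Vertex H))
      (cornerDist β .bottom .left (.edgePath a b hab e k hk : Vertex H)) := by
  obtain ⟨G, W, hG, hL, hJ, hN, hφ⟩ := cornerProfile_edge hy hh hab
  simp only [cornerDist, Profile.ext, (hφ _ _).1, (hφ _ _).2.1, (hφ _ _).2.2.1, (hφ _ _).2.2.2]
  -- Reading the path from its other end turns the right corners into the near ones.
  simp only [edgeVal_symm (k := k) (show k ≤ G + 3 * h by omega)]
  rw [edgeVal_near_top hh b.isLt a.isLt hG (by omega),
    edgeVal_far_top hh b.isLt a.isLt hG (by omega),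
    edgeVal_mid_bottom hh b.isLt a.isLt hG (by omega),
    edgeVal_far_bottom hh b.isLt a.isLt (by omega)]
  constructor <;> omega

theorem branchDists_left {h : ℕ} (hy : y n = 2 * h) (hh : 10 * n ≤ h) (β : Row → Side → Bool)
    {a b : Fin n} (hab : a < b) (e : H.Adj a b) {k : ℕ} (hk : 0 < k ∧ k < y n) :
    BranchDists n h ((n - 1) * y n : ℕ) (a.val * y n : ℕ) a b k
      (cornerDist β .top .left (.branch .left a b hab e k hk : Vertex H))
      (cornerDist β .top .right (.branch .left a b hab e k hk : Vertex H))
      (cornerDist β .bottom .left (.branch .left a b hab e k hk : Vertex H))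
      (cornerDist β .bottom .right (.branch .left a b hab e k hk : Vertex H)) := by
  obtain ⟨G, W, hG, hL, hJ, hN, hφ⟩ := cornerProfile_edge hy hh hab
  have hL4 := two_mul_y_lt_edgeLen hab
  -- The branch starts at `w_1`, position `y` of the edge path, so its value there is a case of the
  -- middle formulas.
  obtain ⟨-, m₁, m₂, m₃, m₄⟩ := midDists hy hh β hab e (k := y n)
    ⟨by omega, by omega⟩ (by omega) (by omega)
  simp only [cornerDist, Profile.ext] at m₁ m₂ m₃ m₄ ⊢
  clear hφ
  generalize Profile.edge _ a b _ = E₁ at m₁ ⊢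
  generalize Profile.edge _ a b _ = E₂ at m₂ ⊢
  generalize Profile.edge _ a b _ = E₃ at m₃ ⊢
  generalize Profile.edge _ a b _ = E₄ at m₄ ⊢
  simp only [cornerProfile, lineDist, endDist]
  generalize a.val * y n = I at *
  generalize b.val * y n = J at *
  generalize (n - 1) * y n = N at *
  subst hJ hN
  rw [hy, hL] at *
  have ha := a.isLt
  have hb := b.isLt
  refine ⟨by omega, by omega, ?_, ?_, ?_, ?_⟩
  · rw [min_eq_right (by omega)]
    omega
  · rw [min_comm, cast_min_eq (c := (I + G + W : ℕ) - (I : ℕ) - b - 1 - k + 2) (p := 2 * h)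
      (q := h + a + b + 2 + 2 * k) (by omega) (by omega)]
    linarith
  · rw [cast_min_eq (c := (I : ℕ) + 2) (p := 4 * h + n - b + k) (q := 6 * h + n + b + 2 - k)
      (by omega) (by omega)]
    linarith
  · rw [cast_min_eq (c := (I + G + W : ℕ) - (I : ℕ) + 2) (p := 3 * h + n - a + k)
      (q := 6 * h + n - b - k) (by omega) (by omega)]
    linarith

theorem branchDists_right {h : ℕ} (hy : y n = 2 * h) (hh : 10 * n ≤ h) (β : Row → Side → Bool)
    {a b : Fin n} (hab : a < b) (e : H.Adj a b) {k : ℕ} (hk : 0 < k ∧ k < y n) :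
    BranchDists n h ((n - 1) * y n : ℕ) ((n - 1) * y n - b.val * y n : ℕ) b a k
      (cornerDist β .top .right (.branch .right a b hab e k hk : Vertex H))
      (cornerDist β .top .left (.branch .right a b hab e k hk : Vertex H))
      (cornerDist β .bottom .right (.branch .right a b hab e k hk : Vertex H))
      (cornerDist β .bottom .left (.branch .right a b hab e k hk : Vertex H)) := by
  obtain ⟨G, W, hG, hL, hJ, hN, hφ⟩ := cornerProfile_edge hy hh hab
  have hL4 := two_mul_y_lt_edgeLen hab
  obtain ⟨-, m₁, m₂, m₃, m₄⟩ := midDists hy hh β hab e (k := edgeLen a b - y n)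
    ⟨by omega, by omega⟩ (by omega) (by omega)
  simp only [cornerDist, Profile.ext] at m₁ m₂ m₃ m₄ ⊢
  clear hφ
  generalize Profile.edge _ a b _ = E₁ at m₁ ⊢
  generalize Profile.edge _ a b _ = E₂ at m₂ ⊢
  generalize Profile.edge _ a b _ = E₃ at m₃ ⊢
  generalize Profile.edge _ a b _ = E₄ at m₄ ⊢
  simp only [cornerProfile, lineDist, endDist]
  generalize a.val * y n = I at *
  generalize b.val * y n = J at *
  generalize (n - 1) * y n = N at *
  subst hJ hN
  rw [hy, hL] at *
  have ha := a.isLt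
  have hb := b.isLt
  refine ⟨by omega, by omega, ?_, ?_, ?_, ?_⟩
  · rw [min_eq_right (by omega)]
    omega
  · rw [min_comm, cast_min_eq (c := (I + G + W : ℕ) - (I + G + W - (I + G) : ℕ) - a - 1 - k + 2) (p := 2 * h)
      (q := h + b + a + 2 + 2 * k) (by omega) (by omega)]
    linarith
  · rw [cast_min_eq (c := (I + G + W - (I + G) : ℕ) + 2) (p := 4 * h + n - a + k) (q := 6 * h + n + a + 2 - k)
      (by omega) (by omega)]
    linarith
  · rw [cast_min_eq (c := (I + G + W : ℕ) - (I + G + W - (I + G) : ℕ) + 2) (p := 3 * h + n - b + k)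
      (q := 6 * h + n - a - k) (by omega) (by omega)]
    linarith

theorem separated_left {h : ℕ} (hy : y n = 2 * h) (a a' : Fin n) :
    Separated h a a' (a.val * y n : ℕ) (a'.val * y n : ℕ) := by
  rcases lt_trichotomy a.val a'.val with h1 | h1 | h1
  · have := mul_y_add_le (n := n) h1
    exact Or.inr ⟨by omega, Or.inl (by omega)⟩
  · exact Or.inl ⟨by omega, by rw [h1]⟩
  · have := mul_y_add_le (n := n) h1
    exact Or.inr ⟨by omega, Or.inr (by omega)⟩

theorem separated_right {h : ℕ} (hy : y n = 2 * h) (b b' : Fin n) :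
    Separated h b b' ((n - 1) * y n - b.val * y n : ℕ) ((n - 1) * y n - b'.val * y n : ℕ) := by
  have h1 := mul_y_le b
  have h2 := mul_y_le b'
  rcases separated_left hy b b' with ⟨h3, h4⟩ | ⟨h3, h4⟩
  · exact Or.inl ⟨h3, by omega⟩
  · exact Or.inr ⟨h3, by omega⟩

theorem separated_left_right {h : ℕ} (hy : y n = 2 * h) (a b : Fin n) :
    Separated h a b (a.val * y n : ℕ)
      (((n - 1) * y n : ℕ) - ((n - 1) * y n - b.val * y n : ℕ)) := by
  have h1 := mul_y_le b
  rcases separated_left hy a b with ⟨h3, h4⟩ | ⟨h3, h4⟩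
  · exact Or.inl ⟨h3, by omega⟩
  · exact Or.inr ⟨h3, by omega⟩

theorem separated_right_left {h : ℕ} (hy : y n = 2 * h) (b a : Fin n) :
    Separated h b a ((n - 1) * y n - b.val * y n : ℕ)
      (((n - 1) * y n : ℕ) - (a.val * y n : ℕ)) := by
  have h1 := mul_y_le b
  rcases separated_left hy b a with ⟨h3, h4⟩ | ⟨h3, h4⟩
  · exact Or.inl ⟨h3, by omega⟩
  · exact Or.inr ⟨h3, by omega⟩

theorem cast_bounds (a : Fin n) : 0 ≤ (a.val : ℤ) ∧ (a.val : ℤ) < n := by omega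

theorem edgePath_branch_left_of_cornerDist_eq {h : ℕ} (hy : y n = 2 * h) (hh : 10 * n ≤ h)
    (β : Row → Side → Bool) {a b a' b' : Fin n} (hab : a < b) (e : H.Adj a b) (hab' : a' < b')
    (e' : H.Adj a' b') {k k' : ℕ} (hk : 0 < k ∧ k < edgeLen a b)
    (hk' : 0 < k' ∧ k' < y n)
    (heq : ∀ c s, cornerDist β c s (.edgePath a b hab e k hk : Vertex H) =
      cornerDist β c s (.branch .left a' b' hab' e' k' hk')) :
    a = a' ∧ b'.val = b.val + 2 * k' ∧ k + k' = y n := by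
  have hw := branchDists_left hy hh β hab' e' hk'
  simp only [← heq] at hw
  rcases le_total k (y n) with h1 | h1
  · have hv := endDists_left hy hh β hab e hk h1
    obtain ⟨q1, q2, q3⟩ := hv.exceptional_of_branch (by omega) (cast_bounds a) (cast_bounds b)
      (cast_bounds a') (cast_bounds b') (separated_left hy a a') hw
    exact ⟨by omega, by omega, by omega⟩
  rcases le_total (k + y n) (edgeLen a b) with h2 | h2
  · have hv := midDists hy hh β hab e hk h1 h2
    exact (hv.not_branch (by omega) (cast_bounds a) (cast_bounds b)
      (cast_bounds a') (cast_bounds b') (separated_left hy a a') hw).elim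
  · have hv := endDists_right hy hh β hab e hk h2
    exact (hv.not_branch_mirror (by omega) (cast_bounds b) (cast_bounds a)
      (cast_bounds b') (cast_bounds a') (separated_right_left hy b a') hw).elim

theorem edgePath_branch_right_of_cornerDist_eq {h : ℕ} (hy : y n = 2 * h) (hh : 10 * n ≤ h)
    (β : Row → Side → Bool) {a b a' b' : Fin n} (hab : a < b) (e : H.Adj a b) (hab' : a' < b')
    (e' : H.Adj a' b') {k k' : ℕ} (hk : 0 < k ∧ k < edgeLen a b)
    (hk' : 0 < k' ∧ k' < y n)
    (heq : ∀ c s, cornerDist β c s (.edgePath a b hab e k hk : Vertex H) =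
      cornerDist β c s (.branch .right a' b' hab' e' k' hk')) :
    b = b' ∧ a'.val = a.val + 2 * k' ∧ edgeLen a b + k' = k + y n := by
  have hw := branchDists_right hy hh β hab' e' hk'
  simp only [← heq] at hw
  rcases le_total (edgeLen a b) (k + y n) with h1 | h1
  · have hv := endDists_right hy hh β hab e hk h1
    obtain ⟨q1, q2, q3⟩ := hv.exceptional_of_branch (by omega) (cast_bounds b) (cast_bounds a)
      (cast_bounds b') (cast_bounds a') (separated_right hy b b') hw
    exact ⟨by omega, by omega, by omega⟩
  rcases le_total k (y n) with h2 | h2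
  · have hv := endDists_left hy hh β hab e hk h2
    exact (hv.not_branch_mirror (by omega) (cast_bounds a) (cast_bounds b)
      (cast_bounds a') (cast_bounds b') (separated_left_right hy a b') hw).elim
  · have hv := midDists hy hh β hab e hk h2 h1
    exact (hv.not_branch_mirror (by omega) (cast_bounds a) (cast_bounds b)
      (cast_bounds a') (cast_bounds b') (separated_left_right hy a b') hw).elim

theorem edgePath_eq_of_cornerDist_eq {h : ℕ} (hy : y n = 2 * h) (hh : 10 * n ≤ h)
    (β : Row → Side → Bool) {a b a' b' : Fin n} (hab : a < b) (e : H.Adj a b) (hab' : a' < b')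
    (e' : H.Adj a' b') {k k' : ℕ} (hk : 0 < k ∧ k < edgeLen a b)
    (hk' : 0 < k' ∧ k' < edgeLen a' b')
    (heq : ∀ c s, cornerDist β c s (.edgePath a b hab e k hk : Vertex H) =
      cornerDist β c s (.edgePath a' b' hab' e' k' hk')) :
    a = a' ∧ b = b' ∧ k = k' := by
  -- Near the right end the position is counted backwards.
  suffices hs : a = a' ∧ b = b' ∧ (k = k' ∨ edgeLen a b - k = edgeLen a' b' - k') by
    obtain ⟨rfl, rfl, hs⟩ := hs
    exact ⟨rfl, rfl, by omega⟩
  have zones : ∀ {a b : Fin n} {k : ℕ}, k ≤ y n ∨ (y n ≤ k ∧ k + y n ≤ edgeLen a b) ∨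
      edgeLen a b < k + y n := by
    intros
    omega
  have hc := cast_bounds a
  have hd := cast_bounds b
  have hc' := cast_bounds a'
  have hd' := cast_bounds b'
  have hlt := Fin.lt_def.1 hab
  have hlt' := Fin.lt_def.1 hab'
  have hh' : 10 * (n : ℤ) ≤ h := by omega
  have hL := two_mul_y_lt_edgeLen hab
  have hL' := two_mul_y_lt_edgeLen hab'
  rcases zones (a := a) (b := b) (k := k) with h1 | h1 | h1
  · have hv := endDists_left hy hh β hab e hk h1
    rcases zones (a := a') (b := b') (k := k') with h2 | h2 | h2
    · have hw := endDists_left hy hh β hab' e' hk' h2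
      simp only [← heq] at hw
      have := hv.eq_of_end hh' hc hd hc' hd' (separated_left hy a a') hw
      exact ⟨by omega, by omega, by omega⟩
    · have hw := midDists hy hh β hab' e' hk' h2.1 h2.2
      simp only [← heq] at hw
      have := hv.eq_of_mid hh' hc hd hc' hd' (separated_left hy a a') hw
      exact ⟨by omega, by omega, by omega⟩
    · have hw := endDists_right hy hh β hab' e' hk' h2.le
      simp only [← heq] at hw
      -- A collision would give `a = b'` and `b = a'`, against `a < b` and `a' < b'`.
      have := hv.eq_of_end_mirror hh' hc hd hc' hd' (separated_left_right hy a b') hw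
      omega
  · have hv := midDists hy hh β hab e hk h1.1 h1.2
    rcases zones (a := a') (b := b') (k := k') with h2 | h2 | h2
    · have hw := endDists_left hy hh β hab' e' hk' h2
      simp only [← heq] at hw
      have := hw.eq_of_mid hh' hc' hd' hc hd (separated_left hy a' a) hv
      exact ⟨by omega, by omega, by omega⟩
    · have hw := midDists hy hh β hab' e' hk' h2.1 h2.2
      simp only [← heq] at hw
      have := hv.eq_of_mid hc hd hc' hd' (separated_left hy a a') hw
      exact ⟨by omega, by omega, by omega⟩
    · have hw := endDists_right hy hh β hab' e' hk' h2.le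
      simp only [← heq] at hw
      -- The only common vertex would be `w_2`, which the strict inequality `h2` excludes.
      have := hv.eq_of_end_mirror hh' hc hd hc' hd' (separated_left_right hy a b') hw
      omega
  · have hv := endDists_right hy hh β hab e hk h1.le
    rcases zones (a := a') (b := b') (k := k') with h2 | h2 | h2
    · have hw := endDists_left hy hh β hab' e' hk' h2
      simp only [← heq] at hw
      have := hw.eq_of_end_mirror hh' hc' hd' hc hd (separated_left_right hy a' b) hv
      omega
    · have hw := midDists hy hh β hab' e' hk' h2.1 h2.2
      simp only [← heq] at hw
      have := hw.eq_of_end_mirror hh' hc' hd' hc hd (separated_left_right hy a' b) hv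
      omega
    · have hw := endDists_right hy hh β hab' e' hk' h2.le
      simp only [← heq] at hw
      have := hv.eq_of_end hh' hd hc hd' hc' (separated_right hy b b') hw
      exact ⟨by omega, by omega, by omega⟩

theorem branch_eq_of_cornerDist_eq {h : ℕ} (hy : y n = 2 * h) (hh : 10 * n ≤ h)
    (β : Row → Side → Bool) {a b a' b' : Fin n} (hab : a < b) (e : H.Adj a b) (hab' : a' < b')
    (e' : H.Adj a' b') {k k' : ℕ}
    {s s' : Side} (hk : 0 < k ∧ k < y n) (hk' : 0 < k' ∧ k' < y n)
    (heq : ∀ c r, cornerDist β c r (.branch s a b hab e k hk : Vertex H) =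
      cornerDist β c r (.branch s' a' b' hab' e' k' hk')) :
    s = s' ∧ a = a' ∧ b = b' ∧ k = k' := by
  have hc := cast_bounds a
  have hd := cast_bounds b
  have hc' := cast_bounds a'
  have hd' := cast_bounds b'
  have hh' : 10 * (n : ℤ) ≤ h := by omega
  cases s <;> cases s'
  · have hv := branchDists_left hy hh β hab e hk
    have hw := branchDists_left hy hh β hab' e' hk'
    simp only [← heq] at hw
    have := hv.eq_of_branch hh' hc hd hc' hd' (separated_left hy a a') hw
    exact ⟨rfl, by omega, by omega, by omega⟩
  · have hv := branchDists_left hy hh β hab e hk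
    have hw := branchDists_right hy hh β hab' e' hk'
    simp only [← heq] at hw
    exact (hv.not_branch_mirror hh' hc hd hc' hd' (separated_left_right hy a b') hw).elim
  · have hv := branchDists_right hy hh β hab e hk
    have hw := branchDists_left hy hh β hab' e' hk'
    simp only [← heq] at hw
    exact (hw.not_branch_mirror hh' hc' hd' hc hd (separated_left_right hy a' b) hv).elim
  · have hv := branchDists_right hy hh β hab e hk
    have hw := branchDists_right hy hh β hab' e' hk'
    simp only [← heq] at hw
    have := hv.eq_of_branch hh' hd hc hd' hc' (separated_right hy b b') hw
    exact ⟨rfl, by omega, by omega, by omega⟩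

/-! ### Coordinates on the ladder; telling ladder, edge gadgets and pending paths apart -/

/-- The position of the projection of a vertex of a line or a vertex gadget to the lines. -/
def column : Vertex H → ℕ
  | .line _ p _ => p
  | .anchor _ i => i.val * y n
  | .arm _ i _ => i.val * y n
  | .spoke _ i _ _ => i.val * y n
  | _ => 0

/-- The distance from a vertex of a line or a vertex gadget to the top line. -/
def depth : Vertex H → ℕ
  | .line .top _ _ => 0
  | .line .bottom _ _ => 2 * y n + n + 1
  | .anchor .top _ => y n
  | .anchor .bottom _ => y n + n + 1
  | .arm _ _ j => y n + 1 + j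
  | .spoke .top _ k _ => y n - k
  | .spoke .bottom _ k _ => y n + n + 1 + k
  | _ => 0

/-- The vertices of the lines and the vertex gadgets. -/
def IsLadder : Vertex H → Prop
  | .line _ _ _ => True
  | .anchor _ _ => True
  | .arm _ _ _ => True
  | .spoke _ _ _ _ => True
  | _ => False

theorem cornerDist_of_isLadder (β : Row → Side → Bool) {v : Vertex H} (hv : IsLadder v) :
    cornerDist β .top .left v = column v + depth v ∧
    cornerDist β .top .right v = ((n - 1) * y n : ℕ) - column v + depth v ∧
    cornerDist β .bottom .left v = column v + (2 * y n + n + 1) - depth v ∧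
    cornerDist β .bottom .right v = ((n - 1) * y n : ℕ) - column v + (2 * y n + n + 1) - depth v := by
  cases v with
  | line c p hp =>
    cases c <;> simp only [cornerDist, Profile.ext, cornerProfile, column, depth, endDist, lineDist]
      <;> omega
  | anchor c i =>
    have := mul_y_le i
    cases c <;> simp only [cornerDist, Profile.ext, cornerProfile, column, depth, endDist,
      anchorDist] <;> omega
  | arm s i j =>
    have := mul_y_le i
    simp only [cornerDist, Profile.ext, cornerProfile, column, depth, endDist, armDist]
    omega
  | spoke c i k hk =>
    have := mul_y_le i
    cases c <;> simp only [cornerDist, Profile.ext, cornerProfile, column, depth, endDist,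
      lineDist, anchorDist] <;> omega
  | pendMid c s => exact hv.elim
  | pendLeaf c s b => exact hv.elim
  | edgePath => exact hv.elim
  | branch => exact hv.elim

theorem fin_eq_of_mul_y_eq {i j : Fin n} (h : i.val * y n = j.val * y n) : i = j :=
  Fin.ext (Nat.eq_of_mul_eq_mul_right (y_pos i.pos) h)

/-- Two vertices are the left and right vertices of the same gadget at the same height. -/
def AreTwins (v w : Vertex H) : Prop :=
  ∃ i j, (v = .arm .left i j ∧ w = .arm .right i j) ∨ (v = .arm .right i j ∧ w = .arm .left i j)

/-- Lines, spokes, anchors and arms occupy disjoint ranges of depth, and off the lines the column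
names the gadget. Only the side of an arm is lost. -/
theorem eq_or_areTwins_of_isLadder {v w : Vertex H} (hv : IsLadder v) (hw : IsLadder w)
    (hc : column v = column w) (hd : depth v = depth w) : v = w ∨ AreTwins v w := by
  cases v with
  | line c p hp =>
    cases w with
    | line c' p' hp' =>
      obtain rfl : p = p' := hc
      cases c <;> cases c' <;> simp only [depth] at hd <;> first | exact Or.inl rfl | omega
    | anchor c' i =>
      have := y_pos i.pos
      cases c <;> cases c' <;> simp only [depth] at hd <;> omega
    | arm s i j =>
      have := y_pos i.pos
      cases c <;> simp only [depth] at hd <;> omega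
    | spoke c' i k hk => cases c <;> cases c' <;> simp only [depth] at hd <;> omega
    | _ => exact hw.elim
  | anchor c i =>
    have := y_pos i.pos
    cases w with
    | line c' p' hp' => cases c <;> cases c' <;> simp only [depth] at hd <;> omega
    | anchor c' i' =>
      obtain rfl := fin_eq_of_mul_y_eq hc
      cases c <;> cases c' <;> simp only [depth] at hd <;> first | exact Or.inl rfl | omega
    | arm s i j => cases c <;> simp only [depth] at hd <;> omega
    | spoke c' i k hk => cases c <;> cases c' <;> simp only [depth] at hd <;> omega
    | _ => exact hw.elim
  | arm s i j =>
    have := y_pos i.pos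
    cases w with
    | line c' p' hp' => cases c' <;> simp only [depth] at hd <;> omega
    | anchor c' i' => cases c' <;> simp only [depth] at hd <;> omega
    | arm s' i' j' =>
      obtain rfl := fin_eq_of_mul_y_eq hc
      simp only [depth] at hd
      obtain rfl : j = j' := by omega
      cases s <;> cases s'
      · exact Or.inl rfl
      · exact Or.inr ⟨i, j, Or.inl ⟨rfl, rfl⟩⟩
      · exact Or.inr ⟨i, j, Or.inr ⟨rfl, rfl⟩⟩
      · exact Or.inl rfl
    | spoke c' i k hk => cases c' <;> simp only [depth] at hd <;> omega
    | _ => exact hw.elim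
  | spoke c i k hk =>
    cases w with
    | line c' p' hp' => cases c <;> cases c' <;> simp only [depth] at hd <;> omega
    | anchor c' i' => cases c <;> cases c' <;> simp only [depth] at hd <;> omega
    | arm s i j => cases c <;> simp only [depth] at hd <;> omega
    | spoke c' i' k' hk' =>
      obtain rfl := fin_eq_of_mul_y_eq hc
      cases c <;> cases c' <;> simp only [depth] at hd <;>
        first | omega | (obtain rfl : k = k' := by omega
                         exact Or.inl rfl)
    | _ => exact hw.elim
  | _ => exact hv.elim

/-- The sum of the distances from the four corners, diminished by `8`. -/
def cornerSum (β : Row → Side → Bool) (v : Vertex H) : ℤ :=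
  cornerDist β .top .left v + cornerDist β .top .right v + cornerDist β .bottom .left v +
    cornerDist β .bottom .right v

/-- A ladder vertex lies on geodesics between both pairs of opposite corners, so column and depth
cancel from the sum. -/
theorem cornerSum_of_isLadder (β : Row → Side → Bool) {v : Vertex H} (hv : IsLadder v) :
    cornerSum β v = 2 * ((n - 1) * y n : ℕ) + 4 * y n + 2 * n + 2 := by
  obtain ⟨h1, h2, h3, h4⟩ := cornerDist_of_isLadder β hv
  rw [cornerSum, h1, h2, h3, h4]
  ring

section
variable {h N X a b k t₁ t₂ t₃ t₄ m : ℤ}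

theorem EndDists.lt_sum (hh : 10 * m ≤ h) (ha : 0 ≤ a ∧ a < m) (hb : 0 ≤ b ∧ b < m)
    (hv : EndDists m h N X a b k t₁ t₂ t₃ t₄) :
    2 * N + 8 * h + 2 * m + 2 < t₁ + t₂ + t₃ + t₄ := by
  have p1 := hv.pos
  rcases hv.zones hh ha hb with ⟨_, _, _, _, _⟩ | ⟨_, _, _, _, _, _⟩ | ⟨_, _, _, _, _, _⟩ |
    ⟨_, _, _, _, _, _⟩ <;> linarith

theorem MidDists.lt_sum (hh : 10 * m ≤ h) (ha : 0 ≤ a ∧ a < m)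
    (hv : MidDists m h N X a b k t₁ t₂ t₃ t₄) :
    2 * N + 8 * h + 2 * m + 2 < t₁ + t₂ + t₃ + t₄ := by
  obtain ⟨_, _, _, _, _⟩ := hv
  linarith

theorem BranchDists.lt_sum (hh : 10 * m ≤ h) (ha : 0 ≤ a ∧ a < m) (hb : 0 ≤ b ∧ b < m)
    (hv : BranchDists m h N X a b k t₁ t₂ t₃ t₄) :
    2 * N + 8 * h + 2 * m + 2 < t₁ + t₂ + t₃ + t₄ := by
  have p1 := hv.pos
  have p2 := hv.lt
  have p3 := hv.d₁
  rcases hv.zones hh ha hb with ⟨_, _, _, _⟩ | ⟨_, _, _, _, _⟩ | ⟨_, _, _, _, _⟩ | ⟨_, _, _, _⟩ <;>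
    linarith
end

theorem lt_cornerSum_edgePath {h : ℕ} (hy : y n = 2 * h) (hh : 10 * n ≤ h) (β : Row → Side → Bool)
    {a b : Fin n} (hab : a < b) (e : H.Adj a b) {k : ℕ} (hk : 0 < k ∧ k < edgeLen a b) :
    2 * ((n - 1) * y n : ℕ) + 4 * y n + 2 * n + 2 <
      cornerSum β (.edgePath a b hab e k hk : Vertex H) := by
  have hh' : 10 * (n : ℤ) ≤ h := by omega
  have hy' : (y n : ℤ) = 2 * h := by omega
  rw [cornerSum]
  rcases le_total k (y n) with h1 | h1
  · have := (endDists_left hy hh β hab e hk h1).lt_sum hh' (cast_bounds a) (cast_bounds b)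
    linarith
  rcases le_total (k + y n) (edgeLen a b) with h2 | h2
  · have := (midDists hy hh β hab e hk h1 h2).lt_sum hh' (cast_bounds a)
    linarith
  · have := (endDists_right hy hh β hab e hk h2).lt_sum hh' (cast_bounds b) (cast_bounds a)
    linarith

theorem lt_cornerSum_branch {h : ℕ} (hy : y n = 2 * h) (hh : 10 * n ≤ h) (β : Row → Side → Bool)
    {a b : Fin n} (s : Side) (hab : a < b) (e : H.Adj a b) {k : ℕ} (hk : 0 < k ∧ k < y n) :
    2 * ((n - 1) * y n : ℕ) + 4 * y n + 2 * n + 2 <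
      cornerSum β (.branch s a b hab e k hk : Vertex H) := by
  have hh' : 10 * (n : ℤ) ≤ h := by omega
  have hy' : (y n : ℤ) = 2 * h := by omega
  rw [cornerSum]
  cases s
  · have := (branchDists_left hy hh β hab e hk).lt_sum hh' (cast_bounds a) (cast_bounds b)
    linarith
  · have := (branchDists_right hy hh β hab e hk).lt_sum hh' (cast_bounds b) (cast_bounds a)
    linarith

/-- The vertices of the paths that are attached to the ends of the lines. -/
def IsPending : Vertex H → Prop
  | .pendMid _ _ => True
  | .pendLeaf _ _ _ => True
  | _ => False

theorem lt_edgeVal {Y L A B C D k m : ℕ} (hY : 0 < Y) (hk : 0 < k ∧ k < L) (hA : m ≤ A)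
    (hB : m ≤ B) (hC : m ≤ C) (hD : m ≤ D) : m < edgeVal Y L A B C D k :=
  lt_min (lt_min (by omega) (by omega)) (lt_min (by omega) (by omega))

/-- Outside the pending paths, distance 2 from a corner occurs only at the end of its own line. -/
theorem lt_cornerDist_of_not_isPending (β : Row → Side → Bool) (c : Row) (s : Side) {w : Vertex H}
    (hw : ¬IsPending w) : 0 < cornerDist β c s w ∨ ((∃ p hp, w = .line c p hp) ∧
      cornerDist β c s w = 0) := by
  have hl : ∀ c' p, 2 ≤ (cornerProfile n (β c s) c s).line c' p := fun c' p => by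
    simp only [cornerProfile]
    omega
  have ha : ∀ s' i j, 2 ≤ (cornerProfile n (β c s) c s).arm s' i j := fun s' i j => by
    simp only [cornerProfile]
    omega
  cases w with
  | line c' p hp =>
    cases c <;> cases c' <;> simp only [cornerDist, Profile.ext, cornerProfile, lineDist] <;>
      first
      | (left; omega)
      | (rcases Nat.eq_zero_or_pos (endDist n s p) with h0 | h0
         · exact Or.inr ⟨⟨_, _, rfl⟩, by omega⟩
         · exact Or.inl (by omega))
  | pendMid c' s' => exact (hw trivial).elim
  | pendLeaf c' s' b => exact (hw trivial).elim
  | anchor c' i =>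
    have := y_pos i.pos
    left
    cases c <;> cases c' <;> simp only [cornerDist, Profile.ext, cornerProfile, anchorDist] <;> omega
  | arm s' i j =>
    have := y_pos i.pos
    left
    cases c <;> simp only [cornerDist, Profile.ext, cornerProfile, armDist] <;> omega
  | spoke c' i k hk =>
    have := hl c' (i.val * y n)
    left
    simp only [cornerDist, Profile.ext]
    simp only [cornerProfile] at *
    omega
  | edgePath i j hij e k hk =>
    left
    have := lt_edgeVal (y_pos i.pos) hk (ha .right i j) (ha .right j i)
      (hl .top (i.val * y n + (j.val + 1))) (hl .top (j.val * y n - (i.val + 1)))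
    simp only [cornerDist, Profile.ext, Profile.edge]
    omega
  | branch s' i j hij e k hk =>
    left
    have hL := two_mul_y_lt_edgeLen hij
    have h1 := lt_edgeVal (y_pos i.pos) (k := y n) (L := edgeLen i j) ⟨by omega, by omega⟩
      (ha .right i j) (ha .right j i) (hl .top (i.val * y n + (j.val + 1))) (hl .top (j.val * y n - (i.val + 1)))
    have h2 := lt_edgeVal (y_pos i.pos) (k := edgeLen i j - y n) (L := edgeLen i j)
      ⟨by omega, by omega⟩ (ha .right i j)
      (ha .right j i) (hl .top (i.val * y n + (j.val + 1))) (hl .top (j.val * y n - (i.val + 1)))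
    have h3 := hl .top (i.val * y n + (j.val + 1))
    have h4 := hl .top (j.val * y n - (i.val + 1))
    cases s' <;> simp only [cornerDist, Profile.ext, Profile.edge] <;> omega

theorem eq_of_isPending (β : Row → Side → Bool) {v w : Vertex H} (hv : IsPending v)
    (heq : ∀ c s, cornerDist β c s v = cornerDist β c s w) : v = w := by
  by_cases hw : IsPending w
  · cases v with
    | pendMid c s =>
      have := heq c s
      cases w with
      | pendMid c' s' =>
        cases c <;> cases s <;> cases c' <;> cases s' <;> first
          | rfl
          | (simp only [cornerDist, Profile.ext, cornerProfile] at this; omega)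
      | pendLeaf c' s' b =>
        exfalso
        cases c <;> cases s <;> cases c' <;> cases s' <;>
          simp only [cornerDist, Profile.ext, cornerProfile] at this <;>
          (try split at this) <;> omega
      | _ => exact hw.elim
    | pendLeaf c s b =>
      have := heq c s
      cases w with
      | pendMid c' s' =>
        exfalso
        cases c <;> cases s <;> cases c' <;> cases s' <;>
          simp only [cornerDist, Profile.ext, cornerProfile] at this <;>
          (try split at this) <;> omega
      | pendLeaf c' s' b' =>
        have hb : b = b' ∨ (b = β c s ∧ b' ≠ β c s) ∨ (b ≠ β c s ∧ b' = β c s) := by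
          cases b <;> cases b' <;> cases β c s <;> simp
        cases c <;> cases s <;> cases c' <;> cases s' <;>
          simp only [cornerDist, Profile.ext, cornerProfile] at this <;> first
          | (rcases hb with rfl | ⟨h1, h2⟩ | ⟨h1, h2⟩
             · rfl
             · simp [h1, h2] at this
             · simp [h1, h2] at this)
          | (exfalso; split at this <;> omega)
      | _ => exact hw.elim
    | _ => exact hv.elim
  · exfalso
    cases v with
    | pendMid c s =>
      have h1 := heq c s
      have h2 := lt_cornerDist_of_not_isPending β c s hw
      have h3 : cornerDist β c s (.pendMid c s : Vertex H) = -1 := by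
        cases c <;> cases s <;> simp [cornerDist, Profile.ext, cornerProfile]
      omega
    | pendLeaf c s b =>
      have h1 := heq c s
      have h3 : cornerDist β c s (.pendLeaf c s b : Vertex H) ≤ 0 := by
        cases c <;> cases s <;> simp only [cornerDist, Profile.ext, cornerProfile] <;>
          split <;> omega
      rcases lt_cornerDist_of_not_isPending β c s hw with h2 | ⟨⟨p, hp, rfl⟩, h2⟩
      · omega
      -- The leaf not chosen as corner and the end of the line are both at distance 2. The corner at
      -- the opposite end of the line sees the leaf two steps farther away.
      · cases s
        · have h4 := heq c .right
          cases c <;> simp only [cornerDist, Profile.ext, cornerProfile, endDist, endPos, lineDist]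
            at h2 h4 <;> omega
        · have h4 := heq c .left
          cases c <;> simp only [cornerDist, Profile.ext, cornerProfile, endDist, endPos, lineDist]
            at h2 h4 <;> omega
    | _ => exact hv.elim

/-! ### The pairs left unresolved by the corners -/

/-- The pairs of vertices in edge gadgets that no corner resolves. -/
inductive Exceptional : Vertex H → Vertex H → Prop
  | left (a b b' hab e hab' e' k hk k' hk') : b'.val = b.val + 2 * k' → k + k' = y n →
      Exceptional (.edgePath a b hab e k hk) (.branch .left a b' hab' e' k' hk')
  | right (a b a' hab e hab' e' k hk k' hk') : a'.val = a.val + 2 * k' →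
      edgeLen a b + k' = k + y n →
      Exceptional (.edgePath a b hab e k hk) (.branch .right a' b hab' e' k' hk')

theorem eq_or_areTwins_or_exceptional (hn : 2 ≤ n) (β : Row → Side → Bool) {v w : Vertex H}
    (heq : ∀ c s, cornerDist β c s v = cornerDist β c s w) :
    v = w ∨ AreTwins v w ∨ Exceptional v w ∨ Exceptional w v := by
  obtain ⟨h, hy, hh⟩ := exists_half_y hn
  by_cases hpv : IsPending v
  · exact Or.inl (eq_of_isPending β hpv heq)
  by_cases hpw : IsPending w
  · exact Or.inl (eq_of_isPending β hpw fun c s => (heq c s).symm).symm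
  have hsum : cornerSum β v = cornerSum β w := by simp only [cornerSum, heq]
  have gadget : ∀ {v : Vertex H}, ¬IsPending v → ¬IsLadder v →
      2 * ((n - 1) * y n : ℕ) + 4 * y n + 2 * n + 2 < cornerSum β v := by
    intro v hp hl
    cases v with
    | edgePath i j hij e k hk => exact lt_cornerSum_edgePath hy hh β hij e hk
    | branch s i j hij e k hk => exact lt_cornerSum_branch hy hh β s hij e hk
    | pendMid c s => exact (hp trivial).elim
    | pendLeaf c s b => exact (hp trivial).elim
    | _ => exact (hl trivial).elim
  by_cases hlv : IsLadder v <;> by_cases hlw : IsLadder w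
  · obtain ⟨h1, h2, h3, h4⟩ := cornerDist_of_isLadder β hlv
    obtain ⟨h5, h6, h7, h8⟩ := cornerDist_of_isLadder β hlw
    -- The two top corners alone determine column and depth.
    rw [heq] at h1 h2
    exact (eq_or_areTwins_of_isLadder hlv hlw (by omega) (by omega)).imp_right Or.inl
  · have := cornerSum_of_isLadder β hlv
    have := gadget hpw hlw
    omega
  · have := cornerSum_of_isLadder β hlw
    have := gadget hpv hlv
    omega
  · cases v with
    | edgePath a b hab e k hk =>
      cases w with
      | edgePath a' b' hab' e' k' hk' =>
        obtain ⟨rfl, rfl, rfl⟩ := edgePath_eq_of_cornerDist_eq hy hh β hab e hab' e' hk hk' heq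
        exact Or.inl rfl
      | branch s a' b' hab' e' k' hk' =>
        refine Or.inr (Or.inr (Or.inl ?_))
        cases s
        · obtain ⟨rfl, h1, h2⟩ :=
            edgePath_branch_left_of_cornerDist_eq hy hh β hab e hab' e' hk hk' heq
          exact .left _ _ _ _ _ _ _ _ _ _ _ h1 h2
        · obtain ⟨rfl, h1, h2⟩ :=
            edgePath_branch_right_of_cornerDist_eq hy hh β hab e hab' e' hk hk' heq
          exact .right _ _ _ _ _ _ _ _ _ _ _ h1 h2
      | pendMid c s => exact (hpw trivial).elim
      | pendLeaf c s b => exact (hpw trivial).elim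
      | _ => exact (hlw trivial).elim
    | branch s a b hab e k hk =>
      cases w with
      | edgePath a' b' hab' e' k' hk' =>
        refine Or.inr (Or.inr (Or.inr ?_))
        have heq' := fun c s => (heq c s).symm
        cases s
        · obtain ⟨rfl, h1, h2⟩ :=
            edgePath_branch_left_of_cornerDist_eq hy hh β hab' e' hab e hk' hk heq'
          exact .left _ _ _ _ _ _ _ _ _ _ _ h1 h2
        · obtain ⟨rfl, h1, h2⟩ :=
            edgePath_branch_right_of_cornerDist_eq hy hh β hab' e' hab e hk' hk heq'
          exact .right _ _ _ _ _ _ _ _ _ _ _ h1 h2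
      | branch s' a' b' hab' e' k' hk' =>
        obtain ⟨rfl, rfl, rfl, rfl⟩ := branch_eq_of_cornerDist_eq hy hh β hab e hab' e' hk hk' heq
        exact Or.inl rfl
      | pendMid c s => exact (hpw trivial).elim
      | pendLeaf c s b => exact (hpw trivial).elim
      | _ => exact (hlw trivial).elim
    | pendMid c s => exact (hpv trivial).elim
    | pendLeaf c s b => exact (hpv trivial).elim
    | _ => exact (hlv trivial).elim

/-! ### Lower bounds for distances to a vertex gadget -/

/-- The distance between two numbers. -/
def gap (p q : ℕ) : ℕ := (p - q) + (q - p)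

/-- A function on a cycle of a vertex gadget that is `1`-Lipschitz and bounded by `2 * n`. -/
structure CycleFun (n : ℕ) where
  anchor : Row → ℕ
  arm : Side → Fin n → ℕ
  top_arm : ∀ s (j : Fin n), j.val = 0 → Within 1 (anchor .top) (arm s j)
  arm_arm : ∀ s (j j' : Fin n), j'.val = j.val + 1 → Within 1 (arm s j) (arm s j')
  arm_bottom : ∀ s (j : Fin n), j.val + 1 = n → Within 1 (arm s j) (anchor .bottom)
  anchor_le : ∀ c, anchor c ≤ 2 * n
  arm_le : ∀ s j, arm s j ≤ 2 * n

/-- A lower bound for the distance to a set in the `i`-th vertex gadget, in terms of the function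
`q` on the cycle of that gadget. It is exact on the route from the gadget of `α` to the gadget of
`i` through the edge gadget of `αi`. -/
def gadgetProfile (h : ℕ) (i α : Fin n) (q : CycleFun n) : Profile n where
  line _ p := gap p (i.val * y n) + 2 * h
  mid _ s := gap (endPos n s) (i.val * y n) + 2 * h
  leaf _ s _ := gap (endPos n s) (i.val * y n) + 2 * h
  anchor c k := if k = i then q.anchor c else
    if k = α then gap (α.val * y n) (i.val * y n) + 3 * h + q.arm .right α +
      match c with | .top => i.val + 1 | .bottom => n - i.val
    else gap (k.val * y n) (i.val * y n) + 3 * h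
  arm s k t := if k = i then q.arm s t else
    if k = α then gap (α.val * y n) (i.val * y n) + 3 * h + q.arm .right α + gap t.val i.val
    else gap (k.val * y n) (i.val * y n) + 3 * h

section
variable {I P Q h m a b A B : ℕ}

theorem edgeCompatible_of_gap (hh : 10 * m ≤ h) (ha : a < m) (hb : b < m) (hPQ : P + 2 * h ≤ Q)
    (hA : gap P I + 3 * h ≤ A) (hA' : A ≤ gap P I + 3 * h + 3 * m)
    (hB : gap Q I + 3 * h ≤ B) (hB' : B ≤ gap Q I + 3 * h + 3 * m) :
    EdgeCompatible (2 * h) (Q - P + 3 * h) A B (gap (P + (b + 1)) I + 2 * h)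
      (gap (Q - (a + 1)) I + 2 * h) := by
  have t1 : gap P I ≤ gap Q I + (Q - P) := by simp only [gap]; omega
  have t2 : gap Q I ≤ gap P I + (Q - P) := by simp only [gap]; omega
  have t3 : gap (P + (b + 1)) I ≤ gap P I + m := by simp only [gap]; omega
  have t4 : gap P I ≤ gap (P + (b + 1)) I + m := by simp only [gap]; omega
  have t5 : gap (Q - (a + 1)) I ≤ gap Q I + m := by simp only [gap]; omega
  have t6 : gap Q I ≤ gap (Q - (a + 1)) I + m := by simp only [gap]; omega
  generalize gap P I = x at *
  generalize gap Q I = x' at *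
  generalize gap (P + (b + 1)) I = x₁ at *
  generalize gap (Q - (a + 1)) I = x₂ at *
  constructor <;> constructor <;> omega

theorem edgeCompatible_of_left_end (hh : 10 * m ≤ h) (ha : a < m) (hb : b < m)
    (hPQ : P + 2 * h ≤ Q) (hA : A ≤ 2 * m) (hB : Q - P + 3 * h ≤ B) (hB' : B ≤ Q - P + 3 * h + A) :
    EdgeCompatible (2 * h) (Q - P + 3 * h) A B (gap (P + (b + 1)) P + 2 * h)
      (gap (Q - (a + 1)) P + 2 * h) := by
  simp only [gap]
  constructor <;> constructor <;> omega

theorem edgeCompatible_of_right_end (hh : 10 * m ≤ h) (ha : a < m) (hb : b < m)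
    (hPQ : P + 2 * h ≤ Q) (hB : B ≤ 2 * m) (hA : Q - P + 3 * h ≤ A) (hA' : A ≤ Q - P + 3 * h + B) :
    EdgeCompatible (2 * h) (Q - P + 3 * h) A B (gap (P + (b + 1)) Q + 2 * h)
      (gap (Q - (a + 1)) Q + 2 * h) := by
  simp only [gap]
  constructor <;> constructor <;> omega

end

theorem gadgetProfile_arm_bounds {h : ℕ} (i α : Fin n) (q : CycleFun n) (s : Side) {k : Fin n}
    (hk : k ≠ i) (t : Fin n) :
    gap (k.val * y n) (i.val * y n) + 3 * h ≤ (gadgetProfile h i α q).arm s k t ∧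
      (gadgetProfile h i α q).arm s k t ≤ gap (k.val * y n) (i.val * y n) + 3 * h + 3 * n := by
  have h1 := q.arm_le .right α
  have h2 : gap t.val i.val ≤ n := by simp only [gap]; omega
  simp only [gadgetProfile, if_neg hk]
  split_ifs with h3
  · subst h3
    omega
  · omega

theorem edgeLen_eq {a b : Fin n} {h : ℕ} (hy : y n = 2 * h) (hab : a < b) :
    edgeLen a b = b.val * y n - a.val * y n + 3 * h := by
  have h1 := edgeLen_add hab hy
  have h2 := mul_y_add_le (n := n) (Fin.lt_def.1 hab)
  omega

/-- The lines get one spoke length `2 * h` and foreign gadgets `3 * h` beyond the column distance,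
the latter being what an edge path into gadget `i` costs. All further terms are at most `3 * n` and
vanish in the slack `h` wherever neither end is `i`. -/
theorem gadgetProfile_isLipschitz {h : ℕ} (hy : y n = 2 * h) (hh : 10 * n ≤ h) {i α : Fin n}
    (q : CycleFun n) : (gadgetProfile h i α q).IsLipschitz H where
  line c p hp := by
    simp only [gadgetProfile, gap]
    constructor <;> omega
  leaf c s b := by constructor <;> simp only [gadgetProfile] <;> omega
  mid_left c := by constructor <;> simp only [gadgetProfile, endPos] <;> omega
  mid_right c := by constructor <;> simp only [gadgetProfile, endPos] <;> omega
  top_arm s k j hj := by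
    simp only [gadgetProfile]
    split_ifs
    · exact q.top_arm s j hj
    · simp only [gap, hj]
      constructor <;> omega
    · constructor <;> omega
  arm s k j j' hj := by
    simp only [gadgetProfile]
    split_ifs
    · exact q.arm_arm s j j' hj
    · simp only [gap, hj]
      constructor <;> omega
    · constructor <;> omega
  arm_bottom s k j hj := by
    simp only [gadgetProfile]
    split_ifs
    · exact q.arm_bottom s j hj
    · simp only [gap]
      constructor <;> omega
    · constructor <;> omega
  spoke c k := by
    have h1 := q.anchor_le c
    have h2 := q.arm_le .right α
    have h3 := i.isLt
    simp only [gadgetProfile]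
    split_ifs with h4 h5
    · subst h4
      have : gap (k.val * y n) (k.val * y n) = 0 := by simp [gap]
      constructor <;> omega
    · subst h5
      cases c <;> constructor <;> simp only <;> omega
    · constructor <;> omega
  edge a b hab e := by
    have h1 := mul_y_add_le (n := n) (Fin.lt_def.1 hab)
    have h2 : a ≠ b := hab.ne
    rw [edgeLen_eq hy hab]
    by_cases hai : a = i
    · subst hai
      -- The surplus at the far end occurs only for `b = α`, and then it equals the value at the
      -- near end, so the two ends differ by exactly the length of the path.
      have hB : (gadgetProfile h a α q).arm .right b a =
          b.val * y n - a.val * y n + 3 * h + if b = α then q.arm .right α else 0 := by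
        simp only [gadgetProfile, gap, if_neg h2.symm]
        split_ifs with h3
        · subst h3
          omega
        · omega
      have hA : (gadgetProfile h a α q).arm .right a b = q.arm .right b := by
        simp [gadgetProfile]
      have := edgeCompatible_of_left_end (P := a.val * y n) (Q := b.val * y n)
        (A := (gadgetProfile h a α q).arm .right a b)
        (B := (gadgetProfile h a α q).arm .right b a) hh a.isLt b.isLt (by omega)
        (hA ▸ q.arm_le .right b) (by omega) (by
          rw [hA, hB]
          split_ifs with h3
          · rw [h3]
          · omega)
      rw [← hy] at this
      convert this using 1 <;> simp only [gadgetProfile, hy]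
    by_cases hbi : b = i
    · subst hbi
      have hA : (gadgetProfile h b α q).arm .right a b =
          b.val * y n - a.val * y n + 3 * h + if a = α then q.arm .right α else 0 := by
        simp only [gadgetProfile, gap, if_neg h2]
        split_ifs with h3
        · subst h3
          omega
        · omega
      have hB : (gadgetProfile h b α q).arm .right b a = q.arm .right a := by
        simp [gadgetProfile]
      have := edgeCompatible_of_right_end (P := a.val * y n) (Q := b.val * y n)
        (A := (gadgetProfile h b α q).arm .right a b)
        (B := (gadgetProfile h b α q).arm .right b a) hh a.isLt b.isLt (by omega)
        (hB ▸ q.arm_le .right a) (by omega) (by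
          rw [hA, hB]
          split_ifs with h3
          · rw [h3]
          · omega)
      rw [← hy] at this
      convert this using 1 <;> simp only [gadgetProfile, hy]
    · obtain ⟨p1, p2⟩ := gadgetProfile_arm_bounds (h := h) i α q .right hai b
      obtain ⟨p3, p4⟩ := gadgetProfile_arm_bounds (h := h) i α q .right hbi a
      have := edgeCompatible_of_gap hh a.isLt b.isLt (by omega) p1 p2 p3 p4
      rw [← hy] at this
      convert this using 1 <;> simp only [gadgetProfile, hy]

/-! ### Exceptional pairs are resolved by a new isolated vertex -/

/-- The length of the walk from `r^m_1` to a vertex of the top line or of a branch that leaves the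
`m`-th vertex gadget through its top anchor and follows the top line. -/
def topWalkLength (m : Fin n) : Vertex H → ℕ
  | .anchor _ _ => 1
  | .spoke _ _ k _ => 1 + k
  | .line _ p _ => 1 + y n + gap p (m.val * y n)
  | .branch .left i j _ _ k _ =>
      1 + y n + gap (i.val * y n + (j.val + 1)) (m.val * y n) + (y n - k)
  | .branch .right i j _ _ k _ =>
      1 + y n + gap (j.val * y n - (i.val + 1)) (m.val * y n) + (y n - k)
  | _ => 0

theorem edist_rFirst_branch_le (hn : 2 ≤ n) (m : Fin n) (s : Side) {a b : Fin n} (hab : a < b)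
    (e : H.Adj a b) {k : ℕ} (hk : 0 < k ∧ k < y n) :
    (reduction H).edist (rFirst H m) (.branch s a b hab e k hk) ≤
      topWalkLength m (.branch s a b hab e k hk : Vertex H) := by
  have hy : 1 < y n := by simp only [y]; nlinarith
  refine edist_le_of_descent (S := {v | v = rFirst H m ∨ v = .anchor .top m ∨
    (∃ k hk, v = .spoke .top m k hk) ∨ (∃ p hp, v = .line .top p hp) ∨
    ∃ s a b hab e k hk, v = .branch s a b hab e k hk}) ?_
    (Or.inr (Or.inr (Or.inr (Or.inr ⟨s, a, b, hab, e, k, hk, rfl⟩))))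
  rintro v (rfl | rfl | ⟨k, hk, rfl⟩ | ⟨p, hp, rfl⟩ | ⟨s, a, b, hab, e, k, hk, rfl⟩)
  · exact Or.inl rfl
  · exact Or.inr ⟨_, Or.inl rfl, (Step.top_arm .right m ⟨0, m.pos⟩ rfl).adj.symm, by
      simp [topWalkLength]⟩
  · right
    obtain ⟨k, rfl⟩ : ∃ k', k = k' + 1 := ⟨k - 1, by omega⟩
    rcases Nat.eq_zero_or_pos k with rfl | hk0
    · exact ⟨_, Or.inr (Or.inl rfl), (Step.anchor_spoke .top m hk).adj, by simp [topWalkLength]⟩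
    · exact ⟨_, Or.inr (Or.inr (Or.inl ⟨_, _, rfl⟩)),
        (Step.spoke_spoke .top m k ⟨hk0, by omega⟩ hk).adj, by simp [topWalkLength]⟩
  · right
    rcases lt_trichotomy p (m.val * y n) with h1 | rfl | h1
    · have := mul_y_le m
      exact ⟨_, Or.inr (Or.inr (Or.inr (Or.inl ⟨_, _, rfl⟩))),
        (Step.line_line .top p hp (by omega)).adj.symm, by
        simp only [topWalkLength, gap]
        omega⟩
    · exact ⟨_, Or.inr (Or.inr (Or.inl ⟨y n - 1, ⟨by omega, by omega⟩, rfl⟩)),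
        (Step.spoke_line .top m _ _ _ hp (by omega) rfl).adj, by
        simp only [topWalkLength, gap]
        omega⟩
    · obtain ⟨p, rfl⟩ : ∃ p', p = p' + 1 := ⟨p - 1, by omega⟩
      exact ⟨_, Or.inr (Or.inr (Or.inr (Or.inl ⟨_, _, rfl⟩))),
        (Step.line_line .top p (by omega) hp).adj, by
        simp only [topWalkLength, gap]
        omega⟩
  · right
    by_cases hk1 : k + 1 = y n
    · cases s
      · exact ⟨_, Or.inr (Or.inr (Or.inr (Or.inl ⟨_, foot_left_le hab, rfl⟩))),
          (Step.branch_left_line a b hab e k hk _ _ hk1 rfl).adj.symm, by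
          simp only [topWalkLength]
          omega⟩
      · exact ⟨_, Or.inr (Or.inr (Or.inr (Or.inl ⟨_, foot_right_le, rfl⟩))),
          (Step.branch_right_line a b hab e k hk _ _ hk1 (foot_right_add hab)).adj.symm, by
          simp only [topWalkLength]
          omega⟩
    · refine ⟨_, Or.inr (Or.inr (Or.inr (Or.inr ⟨s, a, b, hab, e, k + 1, ⟨by omega, by omega⟩, rfl⟩))),
        (Step.branch_branch s a b hab e k hk _).adj.symm, ?_⟩
      cases s <;> simp only [topWalkLength] <;> omega

/-- The zero function on a cycle. -/
def CycleFun.zero (n : ℕ) : CycleFun n where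
  anchor _ := 0
  arm _ _ := 0
  top_arm _ _ _ := by constructor <;> omega
  arm_arm _ _ _ _ := by constructor <;> omega
  arm_bottom _ _ _ := by constructor <;> omega
  anchor_le _ := by omega
  arm_le _ _ := by omega

theorem ext_le_edist {φ : Profile n} (hφ : φ.IsLipschitz H) {u v : Vertex H} (hu : φ.ext u = 0) :
    (φ.ext v : ℕ∞) ≤ (reduction H).edist u v := by
  have := le_edist_of_lipschitz hφ.ext_le v u
  rwa [hu, Nat.cast_zero, zero_add, SimpleGraph.edist_comm] at this

/-- Seen from `m`, the foot of the branch vertex is nearer by `2k'`, because it is shifted inwards,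
and the vertex itself is nearer to its foot by another `2k'`. The lower bound, which vanishes on the
whole cycle of `m` and so loses the step from `r^m_1` to the anchor, still leaves a strict
inequality. -/
theorem Exceptional.edist_ne (hn : 2 ≤ n) {m : Fin n}
    (hm : ∀ a b, a < b → H.Adj a b → a < m ∧ m < b) {v w : Vertex H} (hvw : Exceptional v w) :
    (reduction H).edist (rFirst H m) v ≠ (reduction H).edist (rFirst H m) w := by
  obtain ⟨h, hy, hh⟩ := exists_half_y hn
  have hφ := gadgetProfile_isLipschitz (H := H) hy hh (i := m) (α := m) (.zero n)
  have h0 : (gadgetProfile h m m (.zero n)).ext (rFirst H m) = 0 := by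
    simp [Profile.ext, gadgetProfile, CycleFun.zero]
  have hw : (reduction H).edist (rFirst H m) w ≤ topWalkLength m w := by
    cases hvw <;> exact edist_rFirst_branch_le hn m _ _ _ _
  suffices hlt : topWalkLength m w < (gadgetProfile h m m (.zero n)).ext v from
    ne_of_gt ((hw.trans_lt (Nat.cast_lt.2 hlt)).trans_le (ext_le_edist hφ h0))
  cases hvw with
  | left a b b' hab e hab' e' k hk k' hk' h1 h2 =>
    obtain ⟨ham, hmb⟩ := hm a b hab e
    have p1 := mul_y_add_le (n := n) (Fin.lt_def.1 ham)
    have p2 := mul_y_add_le (n := n) (Fin.lt_def.1 hmb)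
    simp only [Profile.ext, Profile.edge, topWalkLength, gadgetProfile, if_neg ham.ne, if_neg hmb.ne',
      edgeLen_eq hy hab, gap]
    generalize a.val * y n = P at *
    generalize b.val * y n = Q at *
    generalize m.val * y n = I at *
    rw [hy] at *
    exact lt_min (lt_min (by omega) (by omega)) (lt_min (by omega) (by omega))
  | right a b a' hab e hab' e' k hk k' hk' h1 h2 =>
    obtain ⟨ham, hmb⟩ := hm a b hab e
    have p1 := mul_y_add_le (n := n) (Fin.lt_def.1 ham)
    have p2 := mul_y_add_le (n := n) (Fin.lt_def.1 hmb)
    rw [edgeLen_eq hy hab] at h2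
    simp only [Profile.ext, Profile.edge, topWalkLength, gadgetProfile, if_neg ham.ne, if_neg hmb.ne',
      edgeLen_eq hy hab, gap]
    generalize a.val * y n = P at *
    generalize b.val * y n = Q at *
    generalize m.val * y n = I at *
    rw [hy] at *
    exact lt_min (lt_min (by omega) (by omega)) (lt_min (by omega) (by omega))

/-! ### The unique shortest route through an edge gadget -/

/-- The difference of the heights on a cycle to the height `j`. -/
def CycleFun.height (j : Fin n) : CycleFun n where
  anchor c := match c with | .top => j.val + 1 | .bottom => n - j.val
  arm _ t := gap t.val j.val
  top_arm _ t ht := by constructor <;> simp only [gap] <;> omega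
  arm_arm _ t t' ht := by constructor <;> simp only [gap] <;> omega
  arm_bottom _ t ht := by constructor <;> simp only [gap] <;> omega
  anchor_le c := by cases c <;> simp only <;> omega
  arm_le _ t := by simp only [gap]; omega

/-- The distance on a cycle to the `j`-th vertex of the left arm. -/
def CycleFun.toLeft (j : Fin n) : CycleFun n where
  anchor c := match c with | .top => j.val + 1 | .bottom => n - j.val
  arm s t := match s with
    | .left => gap t.val j.val
    | .right => min (j.val + t.val + 2) (2 * n - j.val - t.val)
  top_arm s t ht := by cases s <;> constructor <;> simp only [gap] <;> omega
  arm_arm s t t' ht := by cases s <;> constructor <;> simp only [gap] <;> omega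
  arm_bottom s t ht := by cases s <;> constructor <;> simp only [gap] <;> omega
  anchor_le c := by cases c <;> simp only <;> omega
  arm_le s t := by cases s <;> simp only [gap] <;> omega

theorem edist_rFirst_rVertex_le (i j : Fin n) :
    (reduction H).edist (rFirst H i) (rVertex H i j) ≤ j.val := by
  let f : Vertex H → ℕ := fun v => match v with
    | .arm _ _ t => t.val
    | _ => 0
  refine edist_le_of_descent (f := f) (S := {v | ∃ t, v = rVertex H i t}) ?_ ⟨j, rfl⟩
  rintro v ⟨t, rfl⟩
  by_cases ht : t.val = 0
  · left
    congr 1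
    exact Fin.ext ht
  · refine Or.inr ⟨_, ⟨⟨t.val - 1, by omega⟩, rfl⟩,
      (Step.arm_arm .right i _ t (by simp; omega)).adj, ?_⟩
    simp only [f]
    omega

theorem adj_rVertex {k t : Fin n} {v : Vertex H} (h : (reduction H).Adj (rVertex H k t) v) :
    (∃ t', v = rVertex H k t' ∧ (t'.val = t.val + 1 ∨ t.val = t'.val + 1)) ∨
    (v = .anchor .top k ∧ t.val = 0) ∨ (v = .anchor .bottom k ∧ t.val + 1 = n) ∨
    (∃ hkt e hk, v = .edgePath k t hkt e 1 hk) ∨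
    (∃ htk e hk, v = .edgePath t k htk e (edgeLen t k - 1) hk) := by
  rw [reduction, SimpleGraph.fromRel_adj] at h
  rcases h.2 with h | h
  · cases h with
    | arm_arm s i j j' hj => exact Or.inl ⟨j', rfl, Or.inl hj⟩
    | arm_bottom s i j hj => exact Or.inr (Or.inr (Or.inl ⟨rfl, hj⟩))
    | arm_edge i j hij e hk => exact Or.inr (Or.inr (Or.inr (Or.inl ⟨_, _, _, rfl⟩)))
  · cases h with
    | top_arm s i j hj => exact Or.inr (Or.inl ⟨rfl, hj⟩)
    | arm_arm s i j j' hj => exact Or.inl ⟨j, rfl, Or.inr hj⟩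
    | edge_arm i j hij e r hr hr' =>
      obtain rfl : r = edgeLen t k - 1 := by omega
      exact Or.inr (Or.inr (Or.inr (Or.inr ⟨_, _, _, rfl⟩)))

theorem adj_edgePath {a b : Fin n} {hab : a < b} {e : H.Adj a b} {k : ℕ}
    {hk : 0 < k ∧ k < edgeLen a b} {v : Vertex H}
    (h : (reduction H).Adj (.edgePath a b hab e k hk) v) :
    (∃ k' hk', v = .edgePath a b hab e k' hk') ∨ v = rVertex H a b ∨ v = rVertex H b a ∨
    (k = y n ∧ ∃ hk', v = .branch .left a b hab e 1 hk') ∨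
    (k + y n = edgeLen a b ∧ ∃ hk', v = .branch .right a b hab e 1 hk') := by
  rw [reduction, SimpleGraph.fromRel_adj] at h
  rcases h.2 with h | h
  · cases h with
    | edge_edge i j hij e k hk hk' => exact Or.inl ⟨_, _, rfl⟩
    | edge_arm i j hij e r hr hr' => exact Or.inr (Or.inr (Or.inl rfl))
    | edge_branch_left i j hij e k hk hk' hy =>
      exact Or.inr (Or.inr (Or.inr (Or.inl ⟨hy, _, rfl⟩)))
    | edge_branch_right i j hij e k hk hk' hy =>
      exact Or.inr (Or.inr (Or.inr (Or.inr ⟨hy, _, rfl⟩)))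
  · cases h with
    | arm_edge i j hij e hk => exact Or.inr (Or.inl rfl)
    | edge_edge i j hij e k hk hk' => exact Or.inl ⟨_, _, rfl⟩

/-- Entering an edge path can only descend if another terminal attracts, that is, if its value plus
its tree distance is at most the value at the entrance. -/
theorem le_edgeVal_one {Y L A B C D : ℕ} (hL : 2 * Y < L) (hB : A < B + L) (hC : A < C + 2 * Y)
    (hD : A < D + L) : A ≤ edgeVal Y L A B C D 1 :=
  le_min (le_min (by omega) (by omega)) (le_min (by omega) (by omega))

theorem le_edgeVal_pred {Y L A B C D : ℕ} (hL : 2 * Y < L) (hA : B < A + L) (hD : B < D + 2 * Y)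
    (hC : B < C + L) : B ≤ edgeVal Y L A B C D (L - 1) :=
  le_min (le_min (by omega) (by omega)) (le_min (by omega) (by omega))

theorem gadgetProfile_arm_self (h : ℕ) (i α : Fin n) (q : CycleFun n) (s : Side) (t : Fin n) :
    (gadgetProfile h i α q).arm s i t = q.arm s t := by
  simp [gadgetProfile]

theorem gadgetProfile_gap_bounds {h : ℕ} (hy : y n = 2 * h) (hh : 10 * n ≤ h) (i : Fin n)
    {a b : Fin n} (hab : a < b) :
    gap (a.val * y n) (i.val * y n) ≤
      gap (b.val * y n) (i.val * y n) + (b.val * y n - a.val * y n) ∧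
    gap (b.val * y n) (i.val * y n) ≤
      gap (a.val * y n) (i.val * y n) + (b.val * y n - a.val * y n) ∧
    gap (a.val * y n) (i.val * y n) ≤ gap (a.val * y n + (b.val + 1)) (i.val * y n) + n ∧
    gap (b.val * y n) (i.val * y n) ≤ gap (b.val * y n - (a.val + 1)) (i.val * y n) + n := by
  have h1 := mul_y_add_le (n := n) (Fin.lt_def.1 hab)
  simp only [gap]
  omega

/-- Only an edge path leading from another gadget into that of `i` can be entered downhill; `hi`
excludes exactly this case. -/
theorem gadgetProfile_le_edge_one {h : ℕ} (hy : y n = 2 * h) (hh : 10 * n ≤ h) (i α : Fin n) (q : CycleFun n)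
    {a b : Fin n} (hab : a < b) (hi : a = i ∨ b ≠ i) :
    (gadgetProfile h i α q).arm .right a b ≤ (gadgetProfile h i α q).edge a b 1 := by
  have hL := two_mul_y_lt_edgeLen hab
  have hL' := edgeLen_eq hy hab
  obtain ⟨t1, t2, t3, t4⟩ := gadgetProfile_gap_bounds hy hh i hab
  have hn := a.isLt
  by_cases hai : a = i
  · subst hai
    have := q.arm_le .right b
    rw [Profile.edge, gadgetProfile_arm_self]
    apply le_edgeVal_one hL <;> simp only [gadgetProfile] <;> omega
  · have hbi : b ≠ i := hi.resolve_left hai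
    obtain ⟨p1, p2⟩ := gadgetProfile_arm_bounds (h := h) i α q .right hai b
    obtain ⟨p3, p4⟩ := gadgetProfile_arm_bounds (h := h) i α q .right hbi a
    rw [Profile.edge]
    generalize (gadgetProfile h i α q).arm .right a b = A at *
    generalize (gadgetProfile h i α q).arm .right b a = B at *
    simp only [gadgetProfile]
    apply le_edgeVal_one hL <;> omega

theorem gadgetProfile_le_edge_pred {h : ℕ} (hy : y n = 2 * h) (hh : 10 * n ≤ h) (i α : Fin n) (q : CycleFun n)
    {a b : Fin n} (hab : a < b) (hi : b = i ∨ a ≠ i) :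
    (gadgetProfile h i α q).arm .right b a ≤
      (gadgetProfile h i α q).edge a b (edgeLen a b - 1) := by
  have hL := two_mul_y_lt_edgeLen hab
  have hL' := edgeLen_eq hy hab
  obtain ⟨t1, t2, t3, t4⟩ := gadgetProfile_gap_bounds hy hh i hab
  have hn := a.isLt
  by_cases hbi : b = i
  · subst hbi
    have := q.arm_le .right a
    rw [Profile.edge, gadgetProfile_arm_self]
    apply le_edgeVal_pred hL <;> simp only [gadgetProfile] <;> omega
  · have hai : a ≠ i := hi.resolve_left hbi
    obtain ⟨p1, p2⟩ := gadgetProfile_arm_bounds (h := h) i α q .right hai b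
    obtain ⟨p3, p4⟩ := gadgetProfile_arm_bounds (h := h) i α q .right hbi a
    rw [Profile.edge]
    generalize (gadgetProfile h i α q).arm .right a b = A at *
    generalize (gadgetProfile h i α q).arm .right b a = B at *
    simp only [gadgetProfile]
    apply le_edgeVal_pred hL <;> omega

/-- The position of a vertex of the path of the edge `ab`, counted from the gadget of `i`. -/
def posFrom (i a b : Fin n) (k : ℕ) : ℕ := if a = i then k else edgeLen a b - k

theorem gadgetProfile_edge {h : ℕ} (hy : y n = 2 * h) (hh : 10 * n ≤ h) {i α : Fin n}
    (q : CycleFun n) {a b : Fin n} (hab : a < b) (hs : s(a, b) = s(α, i)) {k : ℕ}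
    (hk : k ≤ edgeLen a b) :
    (gadgetProfile h i α q).edge a b k = q.arm .right α + posFrom i a b k := by
  have h1 := mul_y_add_le (n := n) (Fin.lt_def.1 hab)
  have hL := edgeLen_eq hy hab
  have h3 := q.arm_le .right α
  rcases Sym2.eq_iff.1 hs with ⟨rfl, rfl⟩ | ⟨rfl, rfl⟩
  · simp only [Profile.edge, gadgetProfile, posFrom, if_neg hab.ne, if_true, gap]
    exact edgeVal_eq (by omega) (by omega) (by omega) (by omega) (by omega)
  · simp only [Profile.edge, gadgetProfile, posFrom, if_neg hab.ne', if_true, gap]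
    exact edgeVal_eq (by omega) (by omega) (by omega) (by omega) (by omega)

/-- At a branching point the way along the edge path is already the best, so no descent leads into
the branch. -/
theorem gadgetProfile_edge_le_branch {h : ℕ} (hy : y n = 2 * h) (hh : 10 * n ≤ h) {i α : Fin n}
    (q : CycleFun n) {a b : Fin n} (hab : a < b) (hs : s(a, b) = s(α, i)) (e : H.Adj a b)
    (hk : 0 < 1 ∧ 1 < y n) :
    (gadgetProfile h i α q).edge a b (y n) ≤
      (gadgetProfile h i α q).ext (.branch .left a b hab e 1 hk : Vertex H) ∧
    (gadgetProfile h i α q).edge a b (edgeLen a b - y n) ≤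
      (gadgetProfile h i α q).ext (.branch .right a b hab e 1 hk : Vertex H) := by
  have h1 := mul_y_add_le (n := n) (Fin.lt_def.1 hab)
  have hL := edgeLen_eq hy hab
  have h3 := q.arm_le .right α
  have ha := a.isLt
  simp only [Profile.ext]
  rw [gadgetProfile_edge hy hh q hab hs (by omega), gadgetProfile_edge hy hh q hab hs (by omega)]
  rcases Sym2.eq_iff.1 hs with ⟨rfl, rfl⟩ | ⟨rfl, rfl⟩
  · simp only [gadgetProfile, posFrom, if_neg hab.ne, gap]
    omega
  · simp only [gadgetProfile, posFrom, if_true, gap]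
    omega

theorem edgeLen_eq_gap {h : ℕ} (hy : y n = 2 * h) {a b i α : Fin n} (hab : a < b)
    (hs : s(a, b) = s(α, i)) : edgeLen a b = gap (α.val * y n) (i.val * y n) + 3 * h := by
  have h1 := mul_y_add_le (n := n) (Fin.lt_def.1 hab)
  have hL := edgeLen_eq hy hab
  rcases Sym2.eq_iff.1 hs with ⟨rfl, rfl⟩ | ⟨rfl, rfl⟩ <;> simp only [gap] <;> omega

section
variable {h : ℕ} {i α j : Fin n}

theorem ext_rVertex_start (hne : α ≠ i) (q : CycleFun n) (t : Fin n) :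
    (gadgetProfile h i α q).ext (rVertex H α t) =
      gap (α.val * y n) (i.val * y n) + 3 * h + q.arm .right α + gap t.val i.val := by
  simp [Profile.ext, gadgetProfile, hne]

theorem ext_rVertex_end (q : CycleFun n) (t : Fin n) :
    (gadgetProfile h i α q).ext (rVertex H i t) = q.arm .right t :=
  gadgetProfile_arm_self h i α q .right t

theorem gap_le_of_mem_uIcc {t : Fin n} (ht : t ∈ Set.uIcc α j) :
    gap t.val j.val ≤ gap α.val j.val := by
  simp only [Set.mem_uIcc, Fin.le_def] at ht
  simp only [gap]
  omega

theorem eq_of_mem_uIcc_of_gap_eq {t t' : Fin n} (ht : t ∈ Set.uIcc α j) (ht' : t' ∈ Set.uIcc α j)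
    (h : gap t.val j.val = gap t'.val j.val) : t = t' := by
  simp only [Set.mem_uIcc, Fin.le_def] at ht ht'
  simp only [gap] at h
  omega

theorem posFrom_bounds {a b : Fin n} {k : ℕ} (hk : 0 < k ∧ k < edgeLen a b) :
    0 < posFrom i a b k ∧ posFrom i a b k < edgeLen a b := by
  simp only [posFrom]
  split_ifs <;> omega

/-- The three pieces of the route take values in disjoint ranges: at most `gap α j` in gadget `i`,
then up to the length of the edge path more, and at least that sum in gadget `α`. On each piece the
value determines the vertex. -/
theorem injOn_gadgetRoute (hy : y n = 2 * h) (hh : 10 * n ≤ h) (hne : α ≠ i) :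
    Set.InjOn (gadgetProfile h i α (.height j)).ext (gadgetRoute H α i j) := by
  have key : ∀ x ∈ gadgetRoute H α i j,
      (∃ t, t ≤ i ∧ x = rVertex H α t ∧ (gadgetProfile h i α (.height j)).ext x =
        gap (α.val * y n) (i.val * y n) + 3 * h + gap α.val j.val + (i.val - t.val)) ∨
      (∃ (a b : Fin n) (hab : a < b) (e : H.Adj a b) (k : ℕ) (hk : 0 < k ∧ k < edgeLen a b),
        s(a, b) = s(α, i) ∧ x = .edgePath a b hab e k hk ∧
        edgeLen a b = gap (α.val * y n) (i.val * y n) + 3 * h ∧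
        0 < posFrom i a b k ∧ posFrom i a b k < edgeLen a b ∧
        (gadgetProfile h i α (.height j)).ext x = gap α.val j.val + posFrom i a b k) ∨
      (∃ t ∈ Set.uIcc α j, x = rVertex H i t ∧
        (gadgetProfile h i α (.height j)).ext x = gap t.val j.val ∧
        gap t.val j.val ≤ gap α.val j.val) := by
    rintro x (⟨t, ht, rfl⟩ | ⟨a, b, hab, e, k, hk, hs, rfl⟩ | ⟨t, ht, rfl⟩)
    · refine Or.inl ⟨t, ht, rfl, ?_⟩
      rw [ext_rVertex_start hne]
      simp only [CycleFun.height, gap]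
      omega
    · obtain ⟨h1, h2⟩ := posFrom_bounds (i := i) hk
      exact Or.inr (Or.inl ⟨a, b, hab, e, k, hk, hs, rfl, edgeLen_eq_gap hy hab hs, h1, h2,
        gadgetProfile_edge hy hh _ hab hs hk.2.le⟩)
    · exact Or.inr (Or.inr ⟨t, ht, rfl, ext_rVertex_end _ _, gap_le_of_mem_uIcc ht⟩)
  intro x hx x' hx' heq
  rcases key x hx with ⟨t, ht, rfl, h1⟩ | ⟨a, b, hab, e, k, hk, hs, rfl, h1, h2, h3, h4⟩ |
    ⟨t, ht, rfl, h1, h2⟩ <;>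
  rcases key x' hx' with ⟨t', ht', rfl, h1'⟩ |
    ⟨a', b', hab', e', k', hk', hs', rfl, h1', h2', h3', h4'⟩ | ⟨t', ht', rfl, h1', h2'⟩
  · rw [Fin.le_def] at ht ht'
    obtain rfl : t = t' := by omega
    rfl
  · omega
  · omega
  · omega
  · have hab2 : a = a' ∧ b = b' := by
      rcases Sym2.eq_iff.1 (hs.trans hs'.symm) with h | ⟨rfl, rfl⟩
      · exact h
      · exact absurd hab hab'.asymm
    obtain ⟨rfl, rfl⟩ := hab2
    have hp : posFrom i a b k = posFrom i a b k' := by omega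
    obtain rfl : k = k' := by
      simp only [posFrom] at hp
      split_ifs at hp <;> omega
    rfl
  · omega
  · omega
  · omega
  · rw [h1, h1'] at heq
    rw [eq_of_mem_uIcc_of_gap_eq ht ht' heq]

/-- Every exit from the route (anchors, other edge paths, branches, arm vertices beyond its ends)
fails to descend. That `CycleFun.height` also vanishes at `l^i_j` does no harm, as no descending
step from the route reaches the left side. -/
theorem mem_gadgetRoute_of_adj (hy : y n = 2 * h) (hh : 10 * n ≤ h) (hne : α ≠ i)
    {u v : Vertex H} (hu : u ∈ gadgetRoute H α i j) (huv : (reduction H).Adj u v)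
    (hlt : (gadgetProfile h i α (.height j)).ext v < (gadgetProfile h i α (.height j)).ext u) :
    v ∈ gadgetRoute H α i j := by
  rcases hu with ⟨t, ht, rfl⟩ | ⟨a, b, hab, e, k, hk, hs, rfl⟩ | ⟨t, ht, rfl⟩
  · rw [Fin.le_def] at ht
    rcases adj_rVertex huv with ⟨t', rfl, ht'⟩ | ⟨rfl, ht0⟩ | ⟨rfl, ht0⟩ | ⟨hkt, e, hk, rfl⟩ |
      ⟨htk, e, hk, rfl⟩
    · rw [ext_rVertex_start hne, ext_rVertex_start hne] at hlt
      simp only [gap] at hlt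
      exact Or.inl ⟨t', by rw [Fin.le_def]; omega, rfl⟩
    · rw [ext_rVertex_start hne] at hlt
      simp only [Profile.ext, gadgetProfile, if_neg hne, if_true, gap] at hlt
      omega
    · rw [ext_rVertex_start hne] at hlt
      simp only [Profile.ext, gadgetProfile, if_neg hne, if_true, gap] at hlt
      omega
    · by_cases hti : t = i
      · subst hti
        exact Or.inr (Or.inl ⟨_, _, _, _, _, _, rfl, rfl⟩)
      · exact absurd hlt (not_lt_of_ge (gadgetProfile_le_edge_one hy hh i α _ hkt (Or.inr hti)))
    · by_cases hti : t = i
      · subst hti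
        exact Or.inr (Or.inl ⟨_, _, _, _, _, _, Sym2.eq_swap, rfl⟩)
      · exact absurd hlt (not_lt_of_ge (gadgetProfile_le_edge_pred hy hh i α _ htk (Or.inr hti)))
  · have hends : ∀ a b, s(a, b) = s(α, i) → rVertex H a b ∈ gadgetRoute H α i j := by
      intro a b hs
      rcases Sym2.eq_iff.1 hs with ⟨rfl, rfl⟩ | ⟨rfl, rfl⟩
      · exact Or.inl ⟨_, le_rfl, rfl⟩
      · exact Or.inr (Or.inr ⟨_, Set.left_mem_uIcc, rfl⟩)
    rcases adj_edgePath huv with ⟨k', hk', rfl⟩ | rfl | rfl | ⟨hky, hk', rfl⟩ | ⟨hky, hk', rfl⟩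
    · exact Or.inr (Or.inl ⟨_, _, _, _, _, _, hs, rfl⟩)
    · exact hends _ _ hs
    · exact hends _ _ (Sym2.eq_swap.trans hs)
    · subst hky
      exact absurd hlt (not_lt_of_ge (gadgetProfile_edge_le_branch hy hh _ hab hs e hk').1)
    · obtain rfl : k = edgeLen a b - y n := by omega
      exact absurd hlt (not_lt_of_ge (gadgetProfile_edge_le_branch hy hh _ hab hs e hk').2)
  · rcases adj_rVertex huv with ⟨t', rfl, ht'⟩ | ⟨rfl, ht0⟩ | ⟨rfl, ht0⟩ | ⟨hkt, e, hk, rfl⟩ |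
      ⟨htk, e, hk, rfl⟩
    · rw [ext_rVertex_end, ext_rVertex_end] at hlt
      simp only [CycleFun.height, gap] at hlt
      refine Or.inr (Or.inr ⟨t', ?_, rfl⟩)
      simp only [Set.mem_uIcc, Fin.le_def] at ht ⊢
      omega
    · rw [ext_rVertex_end] at hlt
      simp only [Profile.ext, gadgetProfile, if_true, CycleFun.height, gap] at hlt
      omega
    · rw [ext_rVertex_end] at hlt
      simp only [Profile.ext, gadgetProfile, if_true, CycleFun.height, gap] at hlt
      omega
    · exact absurd hlt (not_lt_of_ge (gadgetProfile_le_edge_one hy hh i α _ hkt (Or.inl rfl)))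
    · exact absurd hlt (not_lt_of_ge (gadgetProfile_le_edge_pred hy hh i α _ htk (Or.inl rfl)))

theorem exists_mem_gadgetRoute_lt (hy : y n = 2 * h) (hh : 10 * n ≤ h) (hadj : H.Adj α i)
    {u : Vertex H} (hu : u ∈ gadgetRoute H α i j) (hne : u ≠ rVertex H i j) :
    ∃ v ∈ gadgetRoute H α i j, (reduction H).Adj u v ∧
      (gadgetProfile h i α (.height j)).ext v < (gadgetProfile h i α (.height j)).ext u := by
  have hαi : α ≠ i := hadj.ne
  rcases hu with ⟨t, ht, rfl⟩ | ⟨a, b, hab, e, k, hk, hs, rfl⟩ | ⟨t, ht, rfl⟩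
  · rw [Fin.le_def] at ht
    rcases lt_or_eq_of_le ht with hti | hti
    · refine ⟨rVertex H α ⟨t.val + 1, by omega⟩, Or.inl ⟨_, by rw [Fin.le_def]; exact hti, rfl⟩,
        (Step.arm_arm .right α t _ rfl).adj, ?_⟩
      rw [ext_rVertex_start hαi, ext_rVertex_start hαi]
      simp only [gap]
      omega
    · obtain rfl : t = i := Fin.ext hti
      rcases lt_or_gt_of_ne hαi with hlt | hlt
      · have hL := two_mul_y_lt_edgeLen hlt
        have hL' := edgeLen_eq_gap hy hlt rfl
        refine ⟨.edgePath α t hlt hadj 1 ⟨by omega, by omega⟩,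
          Or.inr (Or.inl ⟨_, _, _, _, _, _, rfl, rfl⟩), (Step.arm_edge α t hlt hadj _).adj, ?_⟩
        rw [ext_rVertex_start hαi]
        simp only [Profile.ext]
        rw [gadgetProfile_edge hy hh _ hlt rfl (by omega), posFrom, if_neg hαi]
        omega
      · have hL := two_mul_y_lt_edgeLen hlt
        have hL' := edgeLen_eq_gap hy hlt (Sym2.eq_swap : s(t, α) = s(α, t))
        refine ⟨.edgePath t α hlt hadj.symm (edgeLen t α - 1) ⟨by omega, by omega⟩,
          Or.inr (Or.inl ⟨_, _, _, _, _, _, Sym2.eq_swap, rfl⟩),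
          (Step.edge_arm t α hlt hadj.symm _ _ (by omega)).adj.symm, ?_⟩
        rw [ext_rVertex_start hαi]
        simp only [Profile.ext]
        rw [gadgetProfile_edge hy hh _ hlt Sym2.eq_swap (by omega), posFrom, if_pos rfl]
        omega
  · have hval := gadgetProfile_edge hy hh (.height j) hab hs hk.2.le
    rcases Sym2.eq_iff.1 hs with ⟨rfl, rfl⟩ | ⟨rfl, rfl⟩
    · by_cases hk1 : k + 1 = edgeLen a b
      · refine ⟨rVertex H b a, Or.inr (Or.inr ⟨_, Set.left_mem_uIcc, rfl⟩),
          (Step.edge_arm a b hab e k hk hk1).adj, ?_⟩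
        rw [ext_rVertex_end]
        simp only [Profile.ext]
        rw [hval, posFrom, if_neg hαi]
        omega
      · refine ⟨.edgePath a b hab e (k + 1) ⟨by omega, by omega⟩,
          Or.inr (Or.inl ⟨_, _, _, _, _, _, hs, rfl⟩), (Step.edge_edge a b hab e k hk _).adj, ?_⟩
        simp only [Profile.ext]
        rw [hval, gadgetProfile_edge hy hh _ hab hs (by omega), posFrom, posFrom, if_neg hαi, if_neg hαi]
        omega
    · obtain ⟨k, rfl⟩ : ∃ k', k = k' + 1 := ⟨k - 1, by omega⟩
      rcases Nat.eq_zero_or_pos k with rfl | hk0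
      · refine ⟨rVertex H a b, Or.inr (Or.inr ⟨_, Set.left_mem_uIcc, rfl⟩),
          (Step.arm_edge a b hab e hk).adj.symm, ?_⟩
        rw [ext_rVertex_end]
        simp only [Profile.ext]
        rw [hval, posFrom, if_pos rfl]
        omega
      · refine ⟨.edgePath a b hab e k ⟨hk0, by omega⟩,
          Or.inr (Or.inl ⟨_, _, _, _, _, _, hs, rfl⟩),
          (Step.edge_edge a b hab e k _ hk).adj.symm, ?_⟩
        simp only [Profile.ext]
        rw [hval, gadgetProfile_edge hy hh _ hab hs (by omega), posFrom, posFrom, if_pos rfl, if_pos rfl]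
        omega
  · have htj : t ≠ j := fun h => hne (by rw [h])
    simp only [Set.mem_uIcc, Fin.le_def] at ht
    rcases lt_or_gt_of_ne htj with hlt | hlt <;> rw [Fin.lt_def] at hlt
    · refine ⟨rVertex H i ⟨t.val + 1, by omega⟩, Or.inr (Or.inr ⟨_, ?_, rfl⟩),
        (Step.arm_arm .right i t _ rfl).adj, ?_⟩
      · simp only [Set.mem_uIcc, Fin.le_def]
        omega
      · rw [ext_rVertex_end, ext_rVertex_end]
        simp only [CycleFun.height, gap]
        omega
    · refine ⟨rVertex H i ⟨t.val - 1, by omega⟩, Or.inr (Or.inr ⟨_, ?_, rfl⟩),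
        (Step.arm_arm .right i _ t (by simp; omega)).adj.symm, ?_⟩
      · simp only [Set.mem_uIcc, Fin.le_def]
        omega
      · rw [ext_rVertex_end, ext_rVertex_end]
        simp only [CycleFun.height, gap]
        omega

/-- The route through the edge gadget is the unique shortest path. -/
theorem exists_unique_shortest_gadgetRoute (hy : y n = 2 * h) (hh : 10 * n ≤ h)
    (hadj : H.Adj α i) (j : Fin n) :
    ∃ P : (reduction H).Walk (rFirst H α) (rVertex H i j),
      P.length = gap (α.val * y n) (i.val * y n) + 3 * h + gap α.val j.val + i.val ∧
      (∀ x, x ∈ P.support ↔ x ∈ gadgetRoute H α i j) ∧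
      ∀ Q : (reduction H).Walk (rFirst H α) (rVertex H i j), Q ≠ P → P.length < Q.length := by
  have hne : α ≠ i := hadj.ne
  have hstart : (gadgetProfile h i α (.height j)).ext (rFirst H α) =
      gap (α.val * y n) (i.val * y n) + 3 * h + gap α.val j.val + i.val := by
    rw [ext_rVertex_start hne]
    simp [CycleFun.height, gap]
  obtain ⟨P, hP, hsupp, huniq⟩ := exists_unique_shortest_walk (G := reduction H)
    (g := (gadgetProfile h i α (.height j)).ext) (S := gadgetRoute H α i j) (T := rVertex H i j)
    (u := rFirst H α)
    (Or.inr (Or.inr ⟨j, Set.right_mem_uIcc, rfl⟩)) (injOn_gadgetRoute hy hh hne)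
    (by rw [ext_rVertex_end]; simp [CycleFun.height, gap])
    (gadgetProfile_isLipschitz hy hh _).ext_le
    (fun u hu v huv hlt => mem_gadgetRoute_of_adj hy hh hne hu huv hlt)
    (fun u hu hne' => exists_mem_gadgetRoute_lt hy hh hadj hu hne')
    (Or.inl ⟨_, by simp [Fin.le_def], rfl⟩)
  refine ⟨P, hP.trans hstart, fun x => ?_, huniq⟩
  rw [hsupp, hstart]
  refine and_iff_left_of_imp fun hx => ?_
  rcases hx with ⟨t, ht, rfl⟩ | ⟨a, b, hab, e, k, hk, hs, rfl⟩ | ⟨t, ht, rfl⟩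
  · rw [Fin.le_def] at ht
    rw [ext_rVertex_start hne]
    simp only [CycleFun.height, gap]
    omega
  · have h1 := edgeLen_eq_gap hy hab hs
    have h2 := posFrom_bounds (i := i) hk
    have h3 := gadgetProfile_edge hy hh (.height j) hab hs hk.2.le
    simp only [CycleFun.height] at h3
    simp only [Profile.ext, CycleFun.height]
    omega
  · have := gap_le_of_mem_uIcc ht
    rw [ext_rVertex_end]
    simp only [CycleFun.height]
    omega

/-! ### Twins, and the metric basis -/

/-- The lower bound for `l^i_j` and the length of the route to `r^i_j` differ only in the last
section, inside gadget `i`. From any right vertex at height `t`, the left target needs `min (j + t +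
2) (2n - j - t)` steps, which exceeds `|t - j|`. -/
theorem edist_rFirst_ne_of_dominates (hy : y n = 2 * h) (hh : 10 * n ≤ h)
    (hαi : α = i ∨ H.Adj i α) (j : Fin n) :
    (reduction H).edist (rFirst H α) (.arm .left i j) ≠
      (reduction H).edist (rFirst H α) (rVertex H i j) := by
  have hlip := gadgetProfile_isLipschitz (H := H) hy hh (i := i) (α := α) (.toLeft j)
  have hlow := le_edist_of_lipschitz hlip.ext_le (rFirst H α) (.arm .left i j)
  have h0 : (gadgetProfile h i α (.toLeft j)).ext (.arm .left i j : Vertex H) = 0 := by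
    simp [Profile.ext, gadgetProfile, CycleFun.toLeft, gap]
  rw [h0, Nat.cast_zero, zero_add] at hlow
  have hj := j.isLt
  refine ne_of_gt (lt_of_lt_of_le ?_ hlow)
  by_cases hne : α = i
  · subst hne
    refine (edist_rFirst_rVertex_le α j).trans_lt (Nat.cast_lt.2 ?_)
    rw [ext_rVertex_end]
    simp only [CycleFun.toLeft]
    omega
  · have hadj : H.Adj α i := (hαi.resolve_left hne).symm
    obtain ⟨P, hP, -, -⟩ := exists_unique_shortest_gadgetRoute hy hh hadj j
    refine (SimpleGraph.edist_le P).trans_lt (Nat.cast_lt.2 ?_)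
    rw [hP, ext_rVertex_start hne]
    simp only [CycleFun.toLeft, gap]
    omega

end

/-- The corners leave twins and exceptional pairs. The former are resolved by a member of `K`
dominating their gadget, the latter by `m`. -/
theorem isMetricBasis_basisOf (hn : 2 ≤ n) {m : Fin n}
    (hm : ∀ a b, a < b → H.Adj a b → a < m ∧ m < b) {K : Set (Fin n)} (hK : IsDominatingSet H K)
    (hmK : m ∈ K) (β : Row → Side → Bool) : IsMetricBasis (reduction H) (basisOf H β K) := by
  intro v w hne
  by_contra! hcon
  obtain ⟨h, hy, hh⟩ := exists_half_y hn
  have hcorner : ∀ c s, cornerDist β c s v = cornerDist β c s w := by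
    intro c s
    have := hcon _ (Or.inl ⟨c, s, rfl⟩)
    rw [edist_corner hn, edist_corner hn] at this
    rw [cornerDist, cornerDist, Nat.cast_inj.1 this]
  have hfirst : ∀ i ∈ K, (reduction H).edist (rFirst H i) v = (reduction H).edist (rFirst H i) w :=
    fun i hi => hcon _ (Or.inr ⟨i, hi, rfl⟩)
  rcases eq_or_areTwins_or_exceptional hn β hcorner with heq | ⟨i, j, htw⟩ | hex | hex
  · exact hne heq
  · obtain ⟨α, hα, hαi⟩ := hK i
    rcases htw with ⟨rfl, rfl⟩ | ⟨rfl, rfl⟩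
    · exact edist_rFirst_ne_of_dominates hy hh hαi j (hfirst α hα)
    · exact edist_rFirst_ne_of_dominates hy hh hαi j (hfirst α hα).symm
  · exact hex.edist_ne hn hm (hfirst m hmK)
  · exact hex.edist_ne hn hm (hfirst m hmK).symm

theorem encard_basisOf_le (β : Row → Side → Bool) (K : Set (Fin n)) :
    (basisOf H β K).encard ≤ K.encard + 4 := by
  have h1 : {x : Vertex H | ∃ c s, x = .pendLeaf c s (β c s)} ⊆
      {.pendLeaf .top .left (β .top .left), .pendLeaf .top .right (β .top .right),
        .pendLeaf .bottom .left (β .bottom .left), .pendLeaf .bottom .right (β .bottom .right)} := by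
    rintro x ⟨c, s, rfl⟩
    cases c <;> cases s <;> simp
  have h2 : {x : Vertex H | ∃ c s, x = .pendLeaf c s (β c s)}.encard ≤ 4 := by
    refine (Set.encard_le_encard h1).trans ?_
    refine (Set.encard_insert_le _ _).trans ?_
    rw [show (4 : ℕ∞) = 3 + 1 from rfl]
    gcongr
    refine (Set.encard_insert_le _ _).trans ?_
    rw [show (3 : ℕ∞) = 2 + 1 from rfl]
    gcongr
    refine (Set.encard_insert_le _ _).trans ?_
    rw [Set.encard_singleton]
    rfl
  calc (basisOf H β K).encard ≤ _ := Set.encard_union_le _ _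
    _ ≤ 4 + K.encard := add_le_add h2 (Set.encard_image_le _ _)
    _ = K.encard + 4 := add_comm _ _

/-! ### Dominating sets of the padded graph, and the theorem -/

section
variable {V : Type*} {G₀ : SimpleGraph V}

theorem IsDominatingSet.addTwoIsolated {K : Set V} (hK : IsDominatingSet G₀ K) :
    IsDominatingSet (addTwoIsolated G₀) (Sum.inl '' K ∪ Set.range Sum.inr) := by
  rintro (x | x)
  · obtain ⟨d, hd, hdx⟩ := hK x
    refine ⟨Sum.inl d, Or.inl ⟨d, hd, rfl⟩, ?_⟩
    rcases hdx with rfl | hdx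
    · exact Or.inl rfl
    · exact Or.inr hdx
  · exact ⟨Sum.inr x, Or.inr ⟨x, rfl⟩, Or.inl rfl⟩

/-- An isolated vertex can only be dominated by itself. -/
theorem IsDominatingSet.inr_mem {K : Set (V ⊕ Fin 2)}
    (hK : IsDominatingSet (MetricDim.addTwoIsolated G₀) K) (x : Fin 2) : Sum.inr x ∈ K := by
  obtain ⟨d, hd, rfl | hadj⟩ := hK (Sum.inr x)
  · exact hd
  · rcases d with d | d <;> simp [MetricDim.addTwoIsolated] at hadj

theorem IsDominatingSet.image_num {num : V ⊕ Fin 2 ≃ Fin n} {K : Set (V ⊕ Fin 2)}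
    (hK : IsDominatingSet (MetricDim.addTwoIsolated G₀) K) :
    IsDominatingSet (padded G₀ num) (num '' K) := by
  intro i
  obtain ⟨d, hd, hdi⟩ := hK (num.symm i)
  refine ⟨num d, ⟨d, hd, rfl⟩, ?_⟩
  rcases hdi with rfl | hadj
  · exact Or.inl (num.apply_symm_apply i)
  · exact Or.inr (by simpa [padded, numbered] using hadj)

/-- Every edge joins `V₁` to `V₂`, and the new vertices are numbered between the two parts. -/
theorem padded_adj_separated {V₁ V₂ : Set V} (hbip : G₀.IsBipartiteWith V₁ V₂)
    {num : V ⊕ Fin 2 ≃ Fin n} (hV₁ : ∀ x ∈ V₁, num (Sum.inl x) < num (Sum.inr 0))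
    (hnew : num (Sum.inr 0) < num (Sum.inr 1))
    (hV₂ : ∀ x ∈ V₂, num (Sum.inr 1) < num (Sum.inl x)) (a b : Fin n) (hab : a < b)
    (e : (padded G₀ num).Adj a b) : a < num (Sum.inr 0) ∧ num (Sum.inr 0) < b := by
  obtain ⟨x, rfl⟩ := num.surjective a
  obtain ⟨z, rfl⟩ := num.surjective b
  have e' : (MetricDim.addTwoIsolated G₀).Adj x z := by simpa [padded, numbered] using e
  rcases x with x | x <;> rcases z with z | z <;> simp [MetricDim.addTwoIsolated] at e'
  rcases hbip.mem_of_adj e' with ⟨hx, hz⟩ | ⟨hx, hz⟩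
  · exact ⟨hV₁ x hx, hnew.trans (hV₂ z hz)⟩
  · exact absurd hab (((hV₁ z hz).trans hnew).trans (hV₂ x hx)).asymm

end

end MetricDim

theorem mainTheorem5 {V : Type*} (G₀ : SimpleGraph V) (V₁ V₂ : Set V)
    (hbip : G₀.IsBipartiteWith V₁ V₂) (hcover : V₁ ∪ V₂ = Set.univ)
    (n : ℕ) (num : V ⊕ Fin 2 ≃ Fin n)
    (hV₁ : ∀ x ∈ V₁, num (Sum.inl x) < num (Sum.inr 0))
    (hnew : num (Sum.inr 0) < num (Sum.inr 1))
    (hV₂ : ∀ x ∈ V₂, num (Sum.inr 1) < num (Sum.inl x)) (h : ℕ) :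
    (MetricDim.HasDominatingSet (MetricDim.addTwoIsolated G₀) h →
      MetricDim.HasMetricBasis (MetricDim.reduction (MetricDim.padded G₀ num)) (h + 4)) ∧
    (MetricDim.HasDominatingSet G₀ h →
      MetricDim.HasMetricBasis (MetricDim.reduction (MetricDim.padded G₀ num)) ((h + 2) + 4)) ∧
    (∀ K : Set (V ⊕ Fin 2),
      MetricDim.IsDominatingSet (MetricDim.addTwoIsolated G₀) K → K.encard ≤ h →
      ∀ b : MetricDim.Row → MetricDim.Side → Bool,
        MetricDim.IsMetricBasis (MetricDim.reduction (MetricDim.padded G₀ num))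
          (MetricDim.basisOf (MetricDim.padded G₀ num) b (num '' K)) ∧
        (MetricDim.basisOf (MetricDim.padded G₀ num) b (num '' K)).encard ≤ h + 4) ∧
    (∀ α i j : Fin n, (MetricDim.padded G₀ num).Adj α i →
      ∃ P : (MetricDim.reduction (MetricDim.padded G₀ num)).Walk
          (MetricDim.rFirst (MetricDim.padded G₀ num) α)
          (MetricDim.rVertex (MetricDim.padded G₀ num) i j),
        (∀ x, x ∈ P.support ↔ x ∈ MetricDim.gadgetRoute (MetricDim.padded G₀ num) α i j) ∧
        ∀ Q : (MetricDim.reduction (MetricDim.padded G₀ num)).Walk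
            (MetricDim.rFirst (MetricDim.padded G₀ num) α)
            (MetricDim.rVertex (MetricDim.padded G₀ num) i j),
          Q ≠ P → P.length < Q.length) := by
  have hn : 2 ≤ n := by
    have h1 := Fin.lt_def.1 hnew
    have h2 := (num (Sum.inr 1)).isLt
    omega
  have hbasis : ∀ (h : ℕ) (K : Set (V ⊕ Fin 2)),
      MetricDim.IsDominatingSet (MetricDim.addTwoIsolated G₀) K → K.encard ≤ h →
      ∀ b : MetricDim.Row → MetricDim.Side → Bool,
        MetricDim.IsMetricBasis (MetricDim.reduction (MetricDim.padded G₀ num))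
          (MetricDim.basisOf (MetricDim.padded G₀ num) b (num '' K)) ∧
        (MetricDim.basisOf (MetricDim.padded G₀ num) b (num '' K)).encard ≤ h + 4 := by
    intro h K hK hcard b
    -- The first new vertex plays the role of `m`.
    refine ⟨MetricDim.isMetricBasis_basisOf hn
      (MetricDim.padded_adj_separated hbip hV₁ hnew hV₂) hK.image_num ⟨_, hK.inr_mem 0, rfl⟩ b, ?_⟩
    refine (MetricDim.encard_basisOf_le b _).trans ?_
    gcongr
    exact (Set.encard_image_le _ _).trans hcard
  refine ⟨?_, ?_, hbasis h, ?_⟩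
  · rintro ⟨K, hK, hcard⟩
    obtain ⟨h1, h2⟩ := hbasis h K hK hcard fun _ _ => true
    exact ⟨_, h1, by exact_mod_cast h2⟩
  · rintro ⟨K, hK, hcard⟩
    -- Adding both isolated vertices to a dominating set of `G₀` accounts for the `+ 2`.
    have hcard' : (Sum.inl '' K ∪ Set.range (Sum.inr : Fin 2 → V ⊕ Fin 2)).encard ≤
        ((h + 2 : ℕ) : ℕ∞) := by
      refine (Set.encard_union_le _ _).trans ?_
      push_cast
      refine add_le_add ((Set.encard_image_le _ _).trans hcard) ?_
      rw [← Set.image_univ]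
      refine (Set.encard_image_le _ _).trans ?_
      simp [Set.encard_univ]
    obtain ⟨h1, h2⟩ := hbasis (h + 2) _ hK.addTwoIsolated hcard' fun _ _ => true
    exact ⟨_, h1, by exact_mod_cast h2⟩
  · intro α i j hadj
    obtain ⟨h', hy, hh⟩ := MetricDim.exists_half_y hn
    obtain ⟨P, -, hP, hQ⟩ := MetricDim.exists_unique_shortest_gadgetRoute hy hh hadj j
    exact ⟨P, hP, hQ⟩
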